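/- Let $\mu$ be a finite nonnegative Borel measure on $\mathbb R^3$ (the nuclear charge distribution), $W(x)=|x|^{-1}$, $V=\mu*W$, let $c>0$ and $q\in\mathbb N$. Let $u_1,\dots,u_q\in H^2(\mathbb R^3;\mathbb C^2)$ be orthonormal in $L^2(\mathbb R^3;\mathbb C^2)$, put $\gamma=\sum_{n=1}^q|u_n\rangle\langle u_n|$, $\gamma(x,y)=\sum_n u_n(x)u_n(y)^*$, $\rho_\gamma=\sum_n|u_n|^2$, $W_{1,\gamma}=\rho_\gamma*W$, $(W_{2,\gamma}\psi)(x)=\int W(x-y)\gamma(x,y)\psi(y)\,dy$, and suppose that, with real $\lambda_n$, the Hartree–Fock equations $$\Big(-\tfrac12\Delta-V+W_{1,\gamma}-W_{2,\gamma}\Big)u_n=\lambda_nu_n,\qquad n=1,\dots,q,$$ hold. (A Hartree–Fock minimizer $\gamma_*^{\rm HF}$ written as $\sum_{n=1}^q|u_n^{\rm HF}\rangle\langle u_n^{\rm HF}|$ with its orthonormal eigenfunctions $u_n^{\rm HF}$ and eigenvalues $\lambda_n^{\rm HF}$ is of this kind.) Let $\pmb\sigma=(\sigma_1,\sigma_2,\sigma_3)$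 be the Pauli matrices, $\mathcal L=-i\pmb\sigma\cdot\nabla$, and $$E^{(2)}(\gamma)=-\frac1{4c^2}\sum_n\lambda_n\langle\mathcal Lu_n,\mathcal Lu_n\rangle+\frac1{4c^2}\sum_n\langle\mathcal Lu_n,(-V+W_{1,\gamma})\mathcal Lu_n\rangle-\frac1{4c^2}\sum_{m,n}\int_{\mathbb R^3}u_n^*(x)u_m(x)\,\langle\mathcal Lu_m,|x-\cdot|^{-1}\mathcal Lu_n\rangle\,dx .$$ Then all the terms below are well defined (all integrals converge absolutely) and $$4c^2E^{(2)}(\gamma)=E_{\rm mv}+E_{\rm D}+E_{\rm so},$$ where $$E_{\rm mv}=-\frac12\sum_n\langle u_n,(-\Delta)^2u_n\rangle$$ (in the sense of quadratic forms, $\langle u,(-\Delta)^2u\rangle=\|\Delta u\|^2$), $$E_{\rm D}=\frac12\sum_n\big\langle u_n,[\Delta(-V+W_{1,\gamma})]u_n\big\rangle-\frac12\sum_{m,n}\int_{\mathbb R^3}u_n^*(x)u_m(x)\,\big\langle u_m,[\Delta_yW(x-\cdot)]u_n\big\rangle\,dx,$$ $$E_{\rm so}=\sum_n\big\langle u_n,\pmb\sigma\cdot[\nabla(-V+W_{1,\gamma})\times(-i\nabla)]u_n\big\rangle-\sum_{m,n}\int_{\mathbb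 R^3}u_n^*(x)u_m(x)\,\big\langle u_m,\pmb\sigma\cdot[(\nabla_yW(x-\cdot))\times(-i\nabla)]u_n\big\rangle\,dx .$$ Here gradients of potentials are weak gradients, the distributional Laplacians $\Delta(-V+W_{1,\gamma})$ and $\Delta_yW(x-\cdot)$ are finite signed measures, and $\langle u,\nu v\rangle=\int u^*v\,d\nu$ for such a measure $\nu$, with the continuous representatives of $u,v\in H^2$. -/

import Mathlib

open MeasureTheory TemperedDistribution
open scoped SchwartzMap LineDeriv Laplacian ContDiff InnerProductSpace

noncomputable section

namespace HartreeFock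

/-! ### Spinors, Sobolev functions and weak derivatives -/

/-- Physical space `ℝ³`. -/
abbrev E3 : Type := EuclideanSpace ℝ (Fin 3)

/-- The spin space `ℂ²`. -/
abbrev C2 : Type := EuclideanSpace ℂ (Fin 2)

/-- The non-relativistic one-particle space `L²(ℝ³; ℂ²)`. -/
abbrev HL : Type := Lp C2 2 (volume : Measure E3)

/-- The `k`-th standard basis vector of `ℝ³`. -/
def e (k : Fin 3) : E3 := EuclideanSpace.single k (1 : ℝ)

/-- `u ∈ H²(ℝ³; ℂ²)`. -/
def InH2 (u : HL) : Prop := MemSobolev (2 : ℝ) 2 (u : 𝓢'(E3, C2))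

open Classical in
/-- The weak derivative `∂ₖ u ∈ L²` (the value is `0` if the distribution `∂ₖ u` is not in `L²`). -/
def weakPartial (k : Fin 3) (u : HL) : HL :=
  if h : ∃ g : HL, (g : 𝓢'(E3, C2)) = ∂_{e k} (u : 𝓢'(E3, C2)) then h.choose else 0

open Classical in
/-- The weak Laplacian `Δ u ∈ L²` (the value is `0` if the distribution `Δ u` is not in `L²`). -/
def weakLaplacian (u : HL) : HL :=
  if h : ∃ g : HL, (g : 𝓢'(E3, C2)) = Δ (u : 𝓢'(E3, C2)) then h.choose else 0

open Classical in
/-- The continuous representative of `u` (it exists for `u ∈ H²`). It is needed to integrate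
`|u|²` against measures that are singular with respect to Lebesgue measure. -/
def contRep (u : HL) : E3 → C2 :=
  if h : ∃ f : E3 → C2, Continuous f ∧ f =ᵐ[volume] u then h.choose else u

/-- The Pauli matrices `σ₁, σ₂, σ₃`. -/
def pauli : Fin 3 → Matrix (Fin 2) (Fin 2) ℂ :=
  ![!![0, 1; 1, 0], !![0, -Complex.I; Complex.I, 0], !![1, 0; 0, -1]]

/-- The Pauli matrices as operators on `ℂ²`. -/
def sigma (k : Fin 3) : C2 →L[ℂ] C2 := Matrix.toEuclideanCLM (𝕜 := ℂ) (pauli k)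

/-- `ℒ u = -i σ·∇ u`. -/
def diracL (u : HL) : HL := -Complex.I • ∑ k, (sigma k).compLp (weakPartial k u)

/-! ### The potentials and the Hartree–Fock equations -/

/-- The Coulomb potential `W(x) = 1 / |x|`. -/
def coulomb (x : E3) : ℝ := ‖x‖⁻¹

/-- The attractive potential `V = μ * 1/|x|` of a nuclear charge distribution `μ`. -/
def nuclearV (μ : Measure E3) (x : E3) : ℝ := ∫ y, coulomb (x - y) ∂μ

/-- The kernel `γ(x, y) = ∑ₙ uₙ(x) ⊗ uₙ(y)^*` of `γ = ∑ₙ |uₙ⟩⟨uₙ|`, acting on `v ∈ ℂ²`. -/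
def gammaKernel {q : ℕ} (u : Fin q → HL) (x y : E3) (v : C2) : C2 :=
  ∑ n, inner ℂ (u n y) v • u n x

/-- The one-particle density `ρ_γ(x) = ∑ₙ |uₙ(x)|²`. -/
def density {q : ℕ} (u : Fin q → HL) (x : E3) : ℝ := ∑ n, ‖u n x‖ ^ 2

/-- The direct term `W_{1,γ} = ρ_γ * W`. -/
def directW {q : ℕ} (u : Fin q → HL) (x : E3) : ℝ := ∫ y, density u y * coulomb (x - y)

/-- The exchange operator `(W_{2,γ} ψ)(x) = ∫ W(x-y) γ(x,y) ψ(y) dy`. -/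
def exchangeW {q : ℕ} (u : Fin q → HL) (ψ : HL) (x : E3) : C2 :=
  ∫ y, (coulomb (x - y) : ℂ) • gammaKernel u x y (ψ y)

/-- The multiplicative potential `-V + W_{1,γ}`. -/
def meanField (μ : Measure E3) {q : ℕ} (u : Fin q → HL) (x : E3) : ℝ :=
  -nuclearV μ x + directW u x

/-- `u₁, …, u_q` is an orthonormal family of eigenfunctions of the Hartree–Fock operator
`H_{0,γ} = -Δ/2 - V + W_{1,γ} - W_{2,γ}` with domain `H²(ℝ³; ℂ²)`, where `γ = ∑ₙ |uₙ⟩⟨uₙ|`,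
with eigenvalues `ε₁, …, ε_q`. -/
structure IsHFState (μ : Measure E3) {q : ℕ} (u : Fin q → HL) (ε : Fin q → ℝ) : Prop where
  orthonormal : Orthonormal ℂ u
  mem_domain : ∀ n, InH2 (u n)
  eigen : ∀ n, ∀ᵐ x : E3, -(1 / 2 : ℂ) • weakLaplacian (u n) x
    + (meanField μ u x : ℂ) • u n x - exchangeW u (u n) x = (ε n : ℂ) • u n x

/-! ### Distributional gradient and Laplacian of a potential -/

/-- `G` is the weak gradient of `Φ`. -/
def IsWeakGradient (Φ : E3 → ℝ) (G : E3 → E3) : Prop :=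
  LocallyIntegrable Φ ∧ LocallyIntegrable G ∧
    ∀ φ : E3 → ℝ, ContDiff ℝ ∞ φ → HasCompactSupport φ → ∀ k : Fin 3,
      ∫ x, Φ x * fderiv ℝ φ x (e k) = -∫ x, G x k * φ x

open Classical in
/-- The weak gradient `∇Φ` (unique almost everywhere when it exists). -/
def weakGrad (Φ : E3 → ℝ) : E3 → E3 :=
  if h : ∃ G, IsWeakGradient Φ G then h.choose else 0

/-- Integrability with respect to a signed measure. -/
def SignedIntegrable (ν : SignedMeasure E3) (f : E3 → ℂ) : Prop :=
  Integrable f ν.toJordanDecomposition.posPart ∧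
    Integrable f ν.toJordanDecomposition.negPart

/-- The integral `∫ f dν` with respect to a signed measure. -/
def signedIntegral (ν : SignedMeasure E3) (f : E3 → ℂ) : ℂ :=
  (∫ x, f x ∂ν.toJordanDecomposition.posPart) - ∫ x, f x ∂ν.toJordanDecomposition.negPart

/-- The distributional Laplacian of `Φ` is the signed measure `ν`. -/
def IsDistribLaplacian (Φ : E3 → ℝ) (ν : SignedMeasure E3) : Prop :=
  LocallyIntegrable Φ ∧
    ∀ φ : E3 → ℝ, ContDiff ℝ ∞ φ → HasCompactSupport φ →
      ((∫ x, Φ x * (Δ φ) x : ℝ) : ℂ) = signedIntegral ν (fun x => (φ x : ℂ))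

open Classical in
/-- The distributional Laplacian `ΔΦ` as a (unique, when it exists) signed measure. -/
def distribLaplacian (Φ : E3 → ℝ) : SignedMeasure E3 :=
  if h : ∃ ν, IsDistribLaplacian Φ ν then h.choose else 0

/-- `(σ·[G × (-i∇)] u)(x)` for a vector field `G`; indices `k+1`, `k+2` are taken modulo `3`, so
that `(a × b)ₖ = a_{k+1} b_{k+2} - a_{k+2} b_{k+1}`. -/
def spinOrbitOp (G : E3 → E3) (u : HL) (x : E3) : C2 :=
  ∑ k : Fin 3, sigma k (-Complex.I •
    ((G x (k + 1) : ℂ) • weakPartial (k + 2) u x - (G x (k + 2) : ℂ) • weakPartial (k + 1) u x))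

/-! ### The leading relativistic correction and its three parts -/

/-- The leading order relativistic correction `E^{(2)}(γ)` for `γ = ∑ₙ |uₙ⟩⟨uₙ|`. -/
def E2 (c : ℝ) (μ : Measure E3) {q : ℕ} (u : Fin q → HL) (ε : Fin q → ℝ) : ℂ :=
  -(1 / (4 * (c : ℂ) ^ 2)) * (∑ n, (ε n : ℂ) * inner ℂ (diracL (u n)) (diracL (u n)))
  + (1 / (4 * (c : ℂ) ^ 2)) *
      (∑ n, (∫ x, inner ℂ (diracL (u n) x) ((meanField μ u x : ℂ) • diracL (u n) x)))
  - (1 / (4 * (c : ℂ) ^ 2)) *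
      (∑ m, ∑ n, (∫ x, inner ℂ (u n x) (u m x) *
        (∫ y, inner ℂ (diracL (u m) y) ((coulomb (x - y) : ℂ) • diracL (u n) y))))

/-- The mass-velocity term `-½ ∑ₙ ⟨uₙ, (-Δ)² uₙ⟩`, where `⟨u, (-Δ)² u⟩ = ⟨-Δu, -Δu⟩` is the
quadratic form of `(-Δ)²`, with form domain `H²`. -/
def Emv {q : ℕ} (u : Fin q → HL) : ℂ :=
  -(1 / 2 : ℂ) * (∑ n, inner ℂ (-weakLaplacian (u n)) (-weakLaplacian (u n)))

/-- The Darwin term. -/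
def ED (μ : Measure E3) {q : ℕ} (u : Fin q → HL) : ℂ :=
  (1 / 2 : ℂ) * (∑ n, signedIntegral (distribLaplacian (meanField μ u))
      (fun x => inner ℂ (contRep (u n) x) (contRep (u n) x)))
  - (1 / 2 : ℂ) * (∑ m, ∑ n, (∫ x, inner ℂ (u n x) (u m x) *
      signedIntegral (distribLaplacian (fun y => coulomb (x - y)))
        (fun y => inner ℂ (contRep (u m) y) (contRep (u n) y))))

/-- The spin-orbit term. -/
def Eso (μ : Measure E3) {q : ℕ} (u : Fin q → HL) : ℂ :=
  (∑ n, (∫ x, inner ℂ (u n x) (spinOrbitOp (weakGrad (meanField μ u)) (u n) x)))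
  - (∑ m, ∑ n, (∫ x, inner ℂ (u n x) (u m x) *
      (∫ y, inner ℂ (u m y) (spinOrbitOp (weakGrad (fun y => coulomb (x - y))) (u n) y))))

/-- Every derivative, representative and integral that enters `E2`, `Emv`, `ED` and `Eso` exists, so
that none of them takes a default value. -/
structure WellDefined (μ : Measure E3) {q : ℕ} (u : Fin q → HL) : Prop where
  weakPartial_eq : ∀ n k,
    (weakPartial k (u n) : 𝓢'(E3, C2)) = ∂_{e k} (u n : 𝓢'(E3, C2))
  weakLaplacian_eq : ∀ n, (weakLaplacian (u n) : 𝓢'(E3, C2)) = Δ (u n : 𝓢'(E3, C2))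
  contRep_spec : ∀ n, Continuous (contRep (u n)) ∧ contRep (u n) =ᵐ[volume] u n
  laplacian_meanField : IsDistribLaplacian (meanField μ u) (distribLaplacian (meanField μ u))
  laplacian_coulomb : ∀ x : E3, IsDistribLaplacian (fun y => coulomb (x - y))
    (distribLaplacian (fun y => coulomb (x - y)))
  gradient_meanField : IsWeakGradient (meanField μ u) (weakGrad (meanField μ u))
  gradient_coulomb : ∀ x : E3, IsWeakGradient (fun y => coulomb (x - y))
    (weakGrad (fun y => coulomb (x - y)))
  integrable_direct : ∀ n, Integrable
    (fun x => inner ℂ (diracL (u n) x) ((meanField μ u x : ℂ) • diracL (u n) x))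
  integrable_exchange_inner : ∀ m n, ∀ x : E3, Integrable
    (fun y => inner ℂ (diracL (u m) y) ((coulomb (x - y) : ℂ) • diracL (u n) y))
  integrable_exchange : ∀ m n, Integrable (fun x => inner ℂ (u n x) (u m x) *
    ∫ y, inner ℂ (diracL (u m) y) ((coulomb (x - y) : ℂ) • diracL (u n) y))
  integrable_darwin : ∀ n, SignedIntegrable (distribLaplacian (meanField μ u))
    (fun x => inner ℂ (contRep (u n) x) (contRep (u n) x))
  integrable_darwin_exchange_inner : ∀ m n, ∀ x : E3,
    SignedIntegrable (distribLaplacian (fun y => coulomb (x - y)))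
      (fun y => inner ℂ (contRep (u m) y) (contRep (u n) y))
  integrable_darwin_exchange : ∀ m n, Integrable (fun x => inner ℂ (u n x) (u m x) *
    signedIntegral (distribLaplacian (fun y => coulomb (x - y)))
      (fun y => inner ℂ (contRep (u m) y) (contRep (u n) y)))
  integrable_spinOrbit : ∀ n, Integrable
    (fun x => inner ℂ (u n x) (spinOrbitOp (weakGrad (meanField μ u)) (u n) x))
  integrable_spinOrbit_exchange_inner : ∀ m n, ∀ x : E3, Integrable
    (fun y => inner ℂ (u m y) (spinOrbitOp (weakGrad (fun y => coulomb (x - y))) (u n) y))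
  integrable_spinOrbit_exchange : ∀ m n, Integrable (fun x => inner ℂ (u n x) (u m x) *
    ∫ y, inner ℂ (u m y) (spinOrbitOp (weakGrad (fun y => coulomb (x - y))) (u n) y))

end HartreeFock

end

open MeasureTheory TemperedDistribution
open scoped SchwartzMap LineDeriv Laplacian ContDiff InnerProductSpace

noncomputable section

namespace HartreeFock

open Filter Topology FourierTransform ComplexConjugate

/-! Every potential in the statement is a superposition of Coulomb kernels `|x - a|⁻¹`: the mean
field comes from the pair of finite measures `μ`, `ρ_γ dx`, the exchange terms from the integrable
weights `uₙ^* uₘ`. It therefore suffices to prove identities for one centre `a` and then to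
integrate over `a`. Write `W = |x - a|⁻¹` and, for `u, v ∈ H²`, let `D`, `L`, `G`, `T`, `S` be
`diracForm`, `laplaceForm`, `gradForm`, `kineticForm`, `spinOrbitForm`. Let `I(h)` be `interaction`,
the direct minus the exchange part of a family `h m n`, and let `κ` be `pointCharge`.

One integration by parts and the Pauli relations give `D = -L - G + S` (`InH2.diracForm_eq`): the
second derivatives `∂ₖ∂ₗv` are symmetric, so only the diagonal of `σₖσₗ` survives there, while the
off-diagonal part paired with `∇W` is the spin-orbit term. Pairing the Hartree–Fock equations with
`Δuₙ` gives `∑ εₙ⟨uₙ, Δuₙ⟩ = E_mv + I(L)`. Since `⟨ℒu, ℒu⟩ = -⟨u, Δu⟩`, the terms `I(L)` cancel and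
`4c²E⁽²⁾ = E_mv + I(S) - I(G)`, where `I(S) = E_so`.

It remains to see that `-I(G)` is the Darwin term. From `-ΔW = κ δₐ` one gets `G(u,v) + conj G(v,u)
= κ u^*v(a)`, which determines only the real part of `I(G)`. Its imaginary part vanishes by a second
use of the equations: `G = -T - L`, the form `T` is Hermitian, and `I(L) = ∑ εₙ⟨uₙ, Δuₙ⟩ - E_mv` is
real. The value of `κ` is irrelevant, because the same constant enters the distributional Laplacian
that defines `E_D`.

The analysis rests on Hardy's inequality with a constant independent of the centre
(`H1Approx.hardy`). It bounds all these forms uniformly in `a`, which is the hypothesis for Fubini's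
theorem (`KernelBound`). Combined with the point-source identity `sum_integral_coulombDeriv` it also
yields the embedding of `H²` into bounded continuous functions. Integrations by parts against `W`
use the kernel `(|z|² + δ²)^{-1/2}` and dominated convergence as `δ → 0`. -/

/-! ### Fourier multipliers on `L²` and approximation of Sobolev functions -/

/-- Multiplication by a bounded continuous function on `L²`. -/
theorem exists_boundedMul (g : E3 → ℂ) (hg : Continuous g) (hb : ∃ C, ∀ x, ‖g x‖ ≤ C) :
    ∃ T : HL →L[ℂ] HL, (∀ f : HL, T f =ᵐ[volume] fun x => g x • f x) ∧
      (g.HasTemperateGrowth → ∀ f : HL, (T f : 𝓢'(E3, C2)) = smulLeftCLM C2 g f) := by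
  obtain ⟨C, hC⟩ := hb
  have hm : MemLp g ⊤ (volume : Measure E3) :=
    memLp_top_of_bound hg.aestronglyMeasurable C (ae_of_all _ hC)
  let T : HL →L[ℂ] HL := LinearMap.mkContinuous
    { toFun := fun f => (hm.toLp g • f : HL)
      map_add' := fun f f' => Lp.add_smul _ _ _
      map_smul' := fun c f => (Lp.smul_comm c (hm.toLp g) f).symm }
    ‖hm.toLp g‖ (fun f => Lp.norm_smul_le _ _)
  have hT : ∀ f, T f = (hm.toLp g • f : HL) := fun f => rfl
  refine ⟨T, fun f => ?_, fun ht f => ?_⟩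
  · rw [hT]
    filter_upwards [Lp.coeFn_lpSMul (r := 2) (hm.toLp g) f, hm.coeFn_toLp] with x h1 h2
    rw [h1, Pi.smul_apply', h2]
  · rw [hT]
    exact Lp.toTemperedDistribution_smul_eq ht hm f

/-- A bounded Fourier multiplier acts on `L²`. -/
theorem exists_fourierMultiplier_L2 (g : E3 → ℂ) (hg : g.HasTemperateGrowth)
    (hb : ∃ C, ∀ x, ‖g x‖ ≤ C) :
    ∃ T : HL →L[ℂ] HL, ∀ f : HL, (T f : 𝓢'(E3, C2)) =
      TemperedDistribution.fourierMultiplierCLM C2 g f := by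
  obtain ⟨T, -, hT⟩ := exists_boundedMul g hg.1.continuous hb
  refine ⟨fourierInvCLM ℂ HL ∘L T ∘L fourierCLM ℂ HL, fun f => ?_⟩
  simp only [ContinuousLinearMap.comp_apply, fourierInvCLM_apply, fourierCLM_apply]
  rw [← Lp.fourierInv_toTemperedDistribution_eq, hT hg, ← Lp.fourier_toTemperedDistribution_eq,
    TemperedDistribution.fourierMultiplierCLM_apply]

theorem toTemperedDistribution_injective {f g : HL}
    (h : (f : 𝓢'(E3, C2)) = (g : 𝓢'(E3, C2))) : f = g := by
  have hk := Lp.ker_toTemperedDistributionCLM_eq_bot (E := E3) (F := C2) (μ := volume) (p := 2)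
  exact (LinearMap.ker_eq_bot.1 hk) h

/-- An `L²` function is determined by its distribution, so the choice in the definition is harmless:
any candidate computes the derivative. -/
theorem weakPartial_eq_of {k : Fin 3} {u g : HL}
    (h : (g : 𝓢'(E3, C2)) = ∂_{e k} (u : 𝓢'(E3, C2))) : weakPartial k u = g := by
  have hex : ∃ g : HL, (g : 𝓢'(E3, C2)) = ∂_{e k} (u : 𝓢'(E3, C2)) := ⟨g, h⟩
  rw [weakPartial, dif_pos hex]
  exact toTemperedDistribution_injective (hex.choose_spec.trans h.symm)

theorem weakLaplacian_eq_of {u g : HL}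
    (h : (g : 𝓢'(E3, C2)) = Δ (u : 𝓢'(E3, C2))) : weakLaplacian u = g := by
  have hex : ∃ g : HL, (g : 𝓢'(E3, C2)) = Δ (u : 𝓢'(E3, C2)) := ⟨g, h⟩
  rw [weakLaplacian, dif_pos hex]
  exact toTemperedDistribution_injective (hex.choose_spec.trans h.symm)

/-- The symbol of the Bessel potential of order `-2`. -/
def besselSymbol (x : E3) : ℂ := ((1 + ‖x‖ ^ 2) ^ (-(2 : ℝ) / 2) : ℝ)

theorem besselSymbol_temperate : besselSymbol.HasTemperateGrowth := by
  unfold besselSymbol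
  fun_prop

theorem norm_besselSymbol (x : E3) : ‖besselSymbol x‖ = (1 + ‖x‖ ^ 2)⁻¹ := by
  rw [besselSymbol, Complex.norm_real, Real.norm_of_nonneg (by positivity)]
  norm_num
  rw [Real.rpow_neg_one]

theorem abs_inner_e_le (k : Fin 3) (x : E3) : |inner ℝ x (e k)| ≤ ‖x‖ := by
  refine (abs_real_inner_le_norm _ _).trans ?_
  simp [e]

/-- A Schwartz function as an element of `L²`. -/
abbrev schwartzL2 (φ : 𝓢(E3, C2)) : HL := φ.toLp 2

/-- `u` is an `L²` limit of Schwartz functions whose partial derivatives converge in `L²` to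
`g`. -/
def H1Approx (u : HL) (g : Fin 3 → HL) : Prop :=
  ∃ φ : ℕ → 𝓢(E3, C2), Tendsto (fun j => schwartzL2 (φ j)) atTop (𝓝 u) ∧
    ∀ k, Tendsto (fun j => schwartzL2 (∂_{e k} (φ j))) atTop (𝓝 (g k))

/-- The symbol of `∂_{e k}`. -/
def derivSymbol (k : Fin 3) (x : E3) : ℂ := (2 * Real.pi * Complex.I) * (inner ℝ x (e k) : ℝ)

theorem derivSymbol_temperate (k : Fin 3) : (derivSymbol k).HasTemperateGrowth := by
  unfold derivSymbol
  fun_prop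

theorem norm_derivSymbol_le (k : Fin 3) (x : E3) : ‖derivSymbol k x‖ ≤ 2 * Real.pi * ‖x‖ := by
  have h := abs_inner_e_le k x
  simp only [derivSymbol, norm_mul, Complex.norm_real, Complex.norm_I, mul_one, Complex.norm_ofNat,
    Real.norm_eq_abs, abs_of_pos Real.pi_pos]
  gcongr

theorem lineDeriv_fourierMultiplier (k : Fin 3) {g : E3 → ℂ} (hg : g.HasTemperateGrowth)
    (f : 𝓢'(E3, C2)) :
    ∂_{e k} (TemperedDistribution.fourierMultiplierCLM C2 g f) =
      TemperedDistribution.fourierMultiplierCLM C2 (g * derivSymbol k) f := by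
  have hi : (fun x : E3 => ((inner ℝ x (e k) : ℝ) : ℂ)).HasTemperateGrowth := by fun_prop
  have : derivSymbol k = (2 * Real.pi * Complex.I) • fun x : E3 => ((inner ℝ x (e k) : ℝ) : ℂ) :=
    rfl
  rw [← TemperedDistribution.fourierMultiplierCLM_fourierMultiplierCLM_apply hg
    (derivSymbol_temperate k), this, TemperedDistribution.fourierMultiplierCLM_smul hi,
    TemperedDistribution.lineDeriv_eq_fourierMultiplierCLM]
  rfl

theorem besselSymbol_deriv_bound (k : Fin 3) :
    ∃ C, ∀ x, ‖(besselSymbol * derivSymbol k) x‖ ≤ C := by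
  refine ⟨2 * Real.pi, fun x => ?_⟩
  rw [Pi.mul_apply, norm_mul, norm_besselSymbol, inv_mul_le_iff₀ (by positivity)]
  refine (norm_derivSymbol_le k x).trans ?_
  nlinarith [Real.pi_pos, sq_nonneg (‖x‖ - 1), mul_nonneg Real.pi_pos.le (sq_nonneg (‖x‖ - 1)),
    mul_nonneg Real.pi_pos.le (sq_nonneg ‖x‖)]

/-- The decay `(1 + |x|²)⁻¹` pays for exactly two derivatives, which is why second derivatives of
`H²` functions lie in `L²`. -/
theorem besselSymbol_deriv_deriv_bound (k l : Fin 3) :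
    ∃ C, ∀ x, ‖(besselSymbol * derivSymbol k * derivSymbol l) x‖ ≤ C := by
  refine ⟨(2 * Real.pi) ^ 2, fun x => ?_⟩
  rw [Pi.mul_apply, Pi.mul_apply, norm_mul, norm_mul, norm_besselSymbol, mul_assoc,
    inv_mul_le_iff₀ (by positivity)]
  calc ‖derivSymbol k x‖ * ‖derivSymbol l x‖ ≤ (2 * Real.pi * ‖x‖) * (2 * Real.pi * ‖x‖) := by
        gcongr <;> exact norm_derivSymbol_le _ x
    _ ≤ (1 + ‖x‖ ^ 2) * (2 * Real.pi) ^ 2 := by nlinarith [sq_nonneg Real.pi]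

theorem lineDeriv_schwartzL2 (k : Fin 3) (φ : 𝓢(E3, C2)) :
    (schwartzL2 (∂_{e k} φ) : 𝓢'(E3, C2)) = ∂_{e k} (schwartzL2 φ : 𝓢'(E3, C2)) := by
  rw [Lp.toTemperedDistribution_toLp_eq, Lp.toTemperedDistribution_toLp_eq,
    lineDerivOp_toTemperedDistributionCLM_eq]

/-- The approximation of a Sobolev function of order two, with the derivatives identified. -/
theorem InH2.exists_approx {u : HL} (hu : InH2 u) :
    (∀ k, (weakPartial k u : 𝓢'(E3, C2)) = ∂_{e k} (u : 𝓢'(E3, C2))) ∧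
    (weakLaplacian u : 𝓢'(E3, C2)) = Δ (u : 𝓢'(E3, C2)) ∧
    (∀ k l, weakPartial l (weakPartial k u) = weakPartial k (weakPartial l u)) ∧
    weakLaplacian u = ∑ k, weakPartial k (weakPartial k u) ∧
    ∃ φ : ℕ → 𝓢(E3, C2), Tendsto (fun j => schwartzL2 (φ j)) atTop (𝓝 u) ∧
      (∀ k, Tendsto (fun j => schwartzL2 (∂_{e k} (φ j))) atTop (𝓝 (weakPartial k u))) ∧
      ∀ k l, Tendsto (fun j => schwartzL2 (∂_{e l} (∂_{e k} (φ j)))) atTop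
        (𝓝 (weakPartial l (weakPartial k u))) := by
  obtain ⟨f, hf⟩ := hu
  have hu' : (u : 𝓢'(E3, C2)) = TemperedDistribution.fourierMultiplierCLM C2 besselSymbol f := by
    rw [← besselPotential_neg_apply_eq_iff] at hf
    exact hf.symm
  have hb := besselSymbol_temperate
  have hb1 : ∀ k, (besselSymbol * derivSymbol k).HasTemperateGrowth :=
    fun k => hb.mul (derivSymbol_temperate k)
  have hb2 : ∀ k l, (besselSymbol * derivSymbol k * derivSymbol l).HasTemperateGrowth :=
    fun k l => (hb1 k).mul (derivSymbol_temperate l)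
  have hbound : ∃ C, ∀ x, ‖besselSymbol x‖ ≤ C := by
    refine ⟨1, fun x => ?_⟩
    rw [norm_besselSymbol]
    exact inv_le_one_of_one_le₀ (by nlinarith [sq_nonneg ‖x‖])
  obtain ⟨T, hT⟩ := exists_fourierMultiplier_L2 _ hb hbound
  -- With `u = T f`, all derivatives of `u` up to order two are bounded operators applied to the
  -- same `f ∈ L²`.
  choose T1 hT1 using fun k => exists_fourierMultiplier_L2 _ (hb1 k) (besselSymbol_deriv_bound k)
  choose T2 hT2 using fun k l =>
    exists_fourierMultiplier_L2 _ (hb2 k l) (besselSymbol_deriv_deriv_bound k l)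
  have huT : u = T f := toTemperedDistribution_injective (by rw [hu', hT])
  have d1 : ∀ (f : HL) k, (T1 k f : 𝓢'(E3, C2)) = ∂_{e k} (T f : 𝓢'(E3, C2)) := by
    intro f k
    rw [hT1, hT, lineDeriv_fourierMultiplier k hb]
  have d2 : ∀ (f : HL) k l, (T2 k l f : 𝓢'(E3, C2)) = ∂_{e l} (T1 k f : 𝓢'(E3, C2)) := by
    intro f k l
    rw [hT1, hT2, lineDeriv_fourierMultiplier l (hb1 k)]
  have w1 : ∀ k, weakPartial k u = T1 k f := fun k => weakPartial_eq_of (by rw [huT, d1])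
  have w2 : ∀ k l, weakPartial l (weakPartial k u) = T2 k l f := fun k l =>
    weakPartial_eq_of (by rw [w1, d2])
  have lap : ((∑ k, T2 k k f : HL) : 𝓢'(E3, C2)) = Δ (u : 𝓢'(E3, C2)) := by
    rw [TemperedDistribution.laplacian_eq_sum (EuclideanSpace.basisFun (Fin 3) ℝ),
      ← Lp.toTemperedDistributionCLM_apply, map_sum]
    refine Finset.sum_congr rfl fun k _ => ?_
    rw [Lp.toTemperedDistributionCLM_apply, d2, d1, ← huT, EuclideanSpace.basisFun_apply]
    rfl
  refine ⟨fun k => by rw [w1, huT, d1], ?_, fun k l => ?_, ?_, ?_⟩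
  · rw [weakLaplacian_eq_of lap, lap]
  · rw [w2, w2]
    refine toTemperedDistribution_injective ?_
    rw [hT2, hT2, mul_right_comm]
  · rw [weakLaplacian_eq_of lap]
    exact Finset.sum_congr rfl fun k _ => (w2 k k).symm
  -- The sequence approximates `f`, not `u`. Applying the Bessel multiplier keeps it Schwartz, and
  -- continuity of `T`, `T1`, `T2` gives convergence of all derivatives at once.
  · have hdense := SchwartzMap.denseRange_toLpCLM (E := E3) (F := C2) (p := 2) (μ := volume)
      (by norm_num)
    obtain ⟨y, hy, hlim⟩ := mem_closure_iff_seq_limit.1 (hdense f)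
    choose g hg using hy
    have hy' : y = fun j => schwartzL2 (g j) := funext fun j => (hg j).symm
    rw [hy'] at hlim
    let φ : ℕ → 𝓢(E3, C2) := fun j => SchwartzMap.fourierMultiplierCLM C2 besselSymbol (g j)
    have e0 : ∀ j, schwartzL2 (φ j) = T (schwartzL2 (g j)) := fun j => by
      refine toTemperedDistribution_injective ?_
      rw [hT, Lp.toTemperedDistribution_toLp_eq, Lp.toTemperedDistribution_toLp_eq,
        fourierMultiplierCLM_toTemperedDistributionCLM_eq hb]
    have e1 : ∀ k j, schwartzL2 (∂_{e k} (φ j)) = T1 k (schwartzL2 (g j)) := fun k j => by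
      refine toTemperedDistribution_injective ?_
      rw [d1, lineDeriv_schwartzL2, e0]
    have e2 : ∀ k l j, schwartzL2 (∂_{e l} (∂_{e k} (φ j))) = T2 k l (schwartzL2 (g j)) :=
      fun k l j => by
      refine toTemperedDistribution_injective ?_
      rw [d2, lineDeriv_schwartzL2, e1]
    refine ⟨φ, ?_, fun k => ?_, fun k l => ?_⟩
    · simp_rw [e0, huT]
      exact (T.continuous.tendsto f).comp hlim
    · simp_rw [e1, w1]
      exact ((T1 k).continuous.tendsto f).comp hlim
    · simp_rw [e2, w2]
      exact ((T2 k l).continuous.tendsto f).comp hlim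

theorem InH2.h1Approx {u : HL} (hu : InH2 u) : H1Approx u (fun k => weakPartial k u) := by
  obtain ⟨-, -, -, -, φ, h0, h1, -⟩ := hu.exists_approx
  exact ⟨φ, h0, h1⟩

theorem InH2.h1Approx_weakPartial {u : HL} (hu : InH2 u) (k : Fin 3) :
    H1Approx (weakPartial k u) (fun l => weakPartial l (weakPartial k u)) := by
  obtain ⟨-, -, -, -, φ, h0, h1, h2⟩ := hu.exists_approx
  exact ⟨fun j => ∂_{e k} (φ j), h1 k, h2 k⟩

theorem H1Approx.of_schwartz (φ : 𝓢(E3, C2)) :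
    H1Approx (schwartzL2 φ) (fun k => schwartzL2 (∂_{e k} φ)) :=
  ⟨fun _ => φ, tendsto_const_nhds, fun _ => tendsto_const_nhds⟩

/-! ### Weak differentiability of scalar products -/

/-- `ψ` is a bounded continuous function with the bounded continuous partial derivative `ψ'`. -/
structure IsMultiplier (k : Fin 3) (ψ ψ' : E3 → ℝ) : Prop where
  continuous : Continuous ψ
  continuous_deriv : Continuous ψ'
  bounded : ∃ C, ∀ x, |ψ x| ≤ C
  bounded_deriv : ∃ C, ∀ x, |ψ' x| ≤ C
  hasLineDerivAt : ∀ x, HasLineDerivAt ℝ ψ (ψ' x) x (e k)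

/-- `f'` is the weak partial derivative of the integrable function `f`, tested against
multipliers. -/
structure HasWeakDeriv (k : Fin 3) (f f' : E3 → ℂ) : Prop where
  integrable : Integrable f
  integrable_deriv : Integrable f'
  ibp : ∀ ψ ψ', IsMultiplier k ψ ψ' → ∫ x, (ψ' x : ℂ) * f x = -∫ x, (ψ x : ℂ) * f' x

theorem integrable_bounded_mul {ψ : E3 → ℝ} (hψ : Continuous ψ) (hb : ∃ C, ∀ x, |ψ x| ≤ C)
    {f : E3 → ℂ} (hf : Integrable f) : Integrable fun x => (ψ x : ℂ) * f x := by
  obtain ⟨C, hC⟩ := hb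
  refine hf.bdd_mul (Complex.continuous_ofReal.comp hψ).aestronglyMeasurable (c := C)
    (ae_of_all _ fun x => ?_)
  simpa using hC x

/-- Classically differentiable integrable functions are weakly differentiable. -/
theorem HasWeakDeriv.of_hasLineDerivAt {k : Fin 3} {f f' : E3 → ℂ} (hf : Integrable f)
    (hf' : Integrable f') (h : ∀ x, HasLineDerivAt ℝ f (f' x) x (e k)) : HasWeakDeriv k f f' := by
  refine ⟨hf, hf', fun ψ ψ' hψ => ?_⟩
  have h1 := integrable_bounded_mul hψ.continuous_deriv hψ.bounded_deriv hf
  have h2 := integrable_bounded_mul hψ.continuous hψ.bounded hf'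
  have h3 := integrable_bounded_mul hψ.continuous hψ.bounded hf
  have key := integral_bilinear_hasLineDerivAt_right_eq_neg_left_of_integrable
    (B := ContinuousLinearMap.lsmul ℝ ℝ (E := ℂ)) (f := ψ) (f' := ψ') (g := f) (g' := f')
    (v := e k) (μ := volume) (by simpa using h1) (by simpa using h2) (by simpa using h3)
    (fun x _ => hψ.hasLineDerivAt x) (fun x _ => h x)
  simp only [ContinuousLinearMap.lsmul_apply, Complex.real_smul] at key
  rw [key, neg_neg]

theorem integrable_inner_clm (M : C2 →L[ℂ] C2) (f g : HL) :
    Integrable fun x => inner ℂ (f x) (M (g x)) := by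
  refine (L2.integrable_inner (𝕜 := ℂ) f (M.compLp g)).congr ?_
  filter_upwards [M.coeFn_compLp g] with x hx
  rw [hx]

/-- Puts a weighted integral into the form `⟨f, T g⟩` with `T` bounded, so that integration by parts
passes from Schwartz functions to `L²` limits. The matrix `M` makes room for products of Pauli
matrices. -/
theorem exists_form_clm (ψ : E3 → ℝ) (hψ : Continuous ψ) (hb : ∃ C, ∀ x, |ψ x| ≤ C)
    (M : C2 →L[ℂ] C2) : ∃ T : HL →L[ℂ] HL, ∀ f g : HL,
      ∫ x, (ψ x : ℂ) * inner ℂ (f x) (M (g x)) = inner ℂ f (T g) := by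
  obtain ⟨T, hT, -⟩ := exists_boundedMul (fun x => (ψ x : ℂ))
    (Complex.continuous_ofReal.comp hψ) (by simpa using hb)
  refine ⟨T ∘L M.compLpL 2 volume, fun f g => ?_⟩
  rw [L2.inner_def]
  refine integral_congr_ae ?_
  filter_upwards [hT (M.compLpL 2 volume g), M.coeFn_compLpL (p := 2) (μ := volume) g]
    with x h1 h2
  rw [ContinuousLinearMap.comp_apply, h1, inner_smul_right, h2]

theorem hasLineDerivAt_inner_clm (M : C2 →L[ℂ] C2) (φ χ : 𝓢(E3, C2)) (k : Fin 3) (x : E3) :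
    HasLineDerivAt ℝ (fun x => inner ℂ (φ x) (M (χ x)))
      (inner ℂ (∂_{e k} φ x) (M (χ x)) + inner ℂ (φ x) (M (∂_{e k} χ x))) x (e k) := by
  have hφ := (φ.differentiable x).hasFDerivAt
  have hχ := ((M.restrictScalars ℝ).hasFDerivAt).comp x (χ.differentiable x).hasFDerivAt
  have hval : inner ℂ (∂_{e k} φ x) (M (χ x)) + inner ℂ (φ x) (M (∂_{e k} χ x)) =
      ((fderivInnerCLM ℂ (φ x, M (χ x))).comp ((fderiv ℝ φ x).prod
        ((M.restrictScalars ℝ).comp (fderiv ℝ χ x)))) (e k) := by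
    simp [SchwartzMap.lineDerivOp_apply_eq_fderiv, fderivInnerCLM_apply, add_comm]
  rw [hval]
  exact (hφ.inner ℂ hχ).hasLineDerivAt (e k)

theorem schwartzL2_coe (φ : 𝓢(E3, C2)) : schwartzL2 φ =ᵐ[volume] φ := φ.coeFn_toLp 2 volume

theorem hasWeakDeriv_schwartz (M : C2 →L[ℂ] C2) (φ χ : 𝓢(E3, C2)) (k : Fin 3) :
    HasWeakDeriv k (fun x => inner ℂ (schwartzL2 φ x) (M (schwartzL2 χ x)))
      (fun x => inner ℂ (schwartzL2 (∂_{e k} φ) x) (M (schwartzL2 χ x)) +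
        inner ℂ (schwartzL2 φ x) (M (schwartzL2 (∂_{e k} χ) x))) := by
  have e1 : (fun x => inner ℂ (schwartzL2 φ x) (M (schwartzL2 χ x))) =ᵐ[volume]
      fun x => inner ℂ (φ x) (M (χ x)) := by
    filter_upwards [schwartzL2_coe φ, schwartzL2_coe χ] with x h1 h2
    rw [h1, h2]
  have e2 : (fun x => inner ℂ (schwartzL2 (∂_{e k} φ) x) (M (schwartzL2 χ x)) +
        inner ℂ (schwartzL2 φ x) (M (schwartzL2 (∂_{e k} χ) x))) =ᵐ[volume]
      fun x => inner ℂ (∂_{e k} φ x) (M (χ x)) + inner ℂ (φ x) (M (∂_{e k} χ x)) := by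
    filter_upwards [schwartzL2_coe φ, schwartzL2_coe χ, schwartzL2_coe (∂_{e k} φ),
      schwartzL2_coe (∂_{e k} χ)] with x h1 h2 h3 h4
    rw [h1, h2, h3, h4]
  have i1 := integrable_inner_clm M (schwartzL2 φ) (schwartzL2 χ)
  have i2 := (integrable_inner_clm M (schwartzL2 (∂_{e k} φ)) (schwartzL2 χ)).add
    (integrable_inner_clm M (schwartzL2 φ) (schwartzL2 (∂_{e k} χ)))
  have h := HasWeakDeriv.of_hasLineDerivAt (i1.congr e1) (i2.congr e2)
    (hasLineDerivAt_inner_clm M φ χ k)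
  refine ⟨i1, i2, fun ψ ψ' hψ => ?_⟩
  have := h.ibp ψ ψ' hψ
  calc _ = ∫ x, (ψ' x : ℂ) * inner ℂ (φ x) (M (χ x)) := by
        refine integral_congr_ae ?_
        filter_upwards [e1] with x hx
        rw [hx]
    _ = _ := this
    _ = _ := by
        congr 1
        refine integral_congr_ae ?_
        filter_upwards [e2] with x hx
        rw [hx]

/-- Leibniz' rule for the scalar product of two weakly differentiable functions. -/
theorem H1Approx.hasWeakDeriv {u w : HL} {g h : Fin 3 → HL} (hu : H1Approx u g)
    (hw : H1Approx w h) (M : C2 →L[ℂ] C2) (k : Fin 3) :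
    HasWeakDeriv k (fun x => inner ℂ (u x) (M (w x)))
      (fun x => inner ℂ (g k x) (M (w x)) + inner ℂ (u x) (M (h k x))) := by
  obtain ⟨φ, hφ, hφ'⟩ := hu
  obtain ⟨χ, hχ, hχ'⟩ := hw
  refine ⟨integrable_inner_clm M u w, (integrable_inner_clm M (g k) w).add
    (integrable_inner_clm M u (h k)), fun ψ ψ' hψ => ?_⟩
  obtain ⟨T, hT⟩ := exists_form_clm ψ hψ.continuous hψ.bounded M
  obtain ⟨T', hT'⟩ := exists_form_clm ψ' hψ.continuous_deriv hψ.bounded_deriv M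
  have split : ∀ a b c d : HL, ∫ x, (ψ x : ℂ) * (inner ℂ (a x) (M (b x)) +
      inner ℂ (c x) (M (d x))) = inner ℂ a (T b) + inner ℂ c (T d) := by
    intro a b c d
    rw [← hT, ← hT, ← integral_add
      (integrable_bounded_mul hψ.continuous hψ.bounded (integrable_inner_clm M a b))
      (integrable_bounded_mul hψ.continuous hψ.bounded (integrable_inner_clm M c d))]
    simp only [mul_add]
  rw [hT', split]
  have hj : ∀ j, inner ℂ (schwartzL2 (φ j)) (T' (schwartzL2 (χ j))) =
      -(inner ℂ (schwartzL2 (∂_{e k} (φ j))) (T (schwartzL2 (χ j))) +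
        inner ℂ (schwartzL2 (φ j)) (T (schwartzL2 (∂_{e k} (χ j))))) := fun j => by
    rw [← hT', ← split]
    exact (hasWeakDeriv_schwartz M (φ j) (χ j) k).ibp ψ ψ' hψ
  have l1 : Tendsto (fun j => inner ℂ (schwartzL2 (φ j)) (T' (schwartzL2 (χ j)))) atTop
      (𝓝 (inner ℂ u (T' w))) := hφ.inner ((T'.continuous.tendsto w).comp hχ)
  have l2 : Tendsto (fun j => -(inner ℂ (schwartzL2 (∂_{e k} (φ j))) (T (schwartzL2 (χ j))) +
        inner ℂ (schwartzL2 (φ j)) (T (schwartzL2 (∂_{e k} (χ j)))))) atTop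
      (𝓝 (-(inner ℂ (g k) (T w) + inner ℂ u (T (h k))))) :=
    (((hφ' k).inner ((T.continuous.tendsto w).comp hχ)).add
      (hφ.inner ((T.continuous.tendsto (h k)).comp (hχ' k)))).neg
  exact tendsto_nhds_unique l1 (by simpa only [hj] using l2)

/-- Test functions are weakly differentiable. -/
theorem hasWeakDeriv_testFunction {φ : E3 → ℝ} (hφ : ContDiff ℝ ∞ φ) (hc : HasCompactSupport φ)
    (k : Fin 3) : HasWeakDeriv k (fun x => (φ x : ℂ)) (fun x => (fderiv ℝ φ x (e k) : ℂ)) := by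
  have h1 : Integrable φ := hφ.continuous.integrable_of_hasCompactSupport hc
  have h2 : Integrable fun x => fderiv ℝ φ x (e k) :=
    ((hφ.continuous_fderiv (by simp)).clm_apply continuous_const).integrable_of_hasCompactSupport
      (hc.fderiv_apply ℝ (e k))
  refine .of_hasLineDerivAt h1.ofReal h2.ofReal fun x => ?_
  have := Complex.ofRealCLM.hasFDerivAt.comp x
    ((hφ.differentiable (by simp)) x).hasFDerivAt
  exact this.hasLineDerivAt (e k)

/-! ### The regularised Coulomb kernel -/

/-- The regularised modulus `√(|z|² + δ²)`. -/
def regNorm (δ : ℝ) (z : E3) : ℝ := √(‖z‖ ^ 2 + δ ^ 2)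

theorem regNorm_sq (δ : ℝ) (z : E3) : regNorm δ z ^ 2 = ‖z‖ ^ 2 + δ ^ 2 :=
  Real.sq_sqrt (by positivity)

theorem regNorm_pos {δ : ℝ} (hδ : 0 < δ) (z : E3) : 0 < regNorm δ z :=
  Real.sqrt_pos.2 (by positivity)

theorem le_regNorm (δ : ℝ) (z : E3) : δ ≤ regNorm δ z :=
  Real.le_sqrt_of_sq_le (by nlinarith [sq_nonneg ‖z‖])

theorem norm_le_regNorm (δ : ℝ) (z : E3) : ‖z‖ ≤ regNorm δ z :=
  Real.le_sqrt_of_sq_le (by nlinarith [sq_nonneg δ])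

theorem abs_coord_le_norm (z : E3) (k : Fin 3) : |z k| ≤ ‖z‖ := by
  simpa using PiLp.norm_apply_le z k

theorem sum_coord_sq (z : E3) : ∑ k, z k ^ 2 = ‖z‖ ^ 2 := by
  simp [EuclideanSpace.norm_sq_eq]

theorem continuous_regNorm (δ : ℝ) : Continuous (regNorm δ) := by
  unfold regNorm
  fun_prop

theorem inner_e (z : E3) (k : Fin 3) : inner ℝ z (e k) = z k := by
  simp [e, EuclideanSpace.inner_single_right]

theorem e_apply (k l : Fin 3) : e k l = if l = k then 1 else 0 := by
  simp [e]

theorem hasFDerivAt_regNorm {δ : ℝ} (hδ : 0 < δ) (z : E3) :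
    HasFDerivAt (regNorm δ) ((regNorm δ z)⁻¹ • innerSL ℝ z) z := by
  have h1 : HasFDerivAt (fun z : E3 => ‖z‖ ^ 2 + δ ^ 2) (2 • innerSL ℝ z) z :=
    (hasStrictFDerivAt_norm_sq z).hasFDerivAt.add_const _
  have h2 := h1.sqrt (by positivity)
  refine HasFDerivAt.congr_fderiv (f := regNorm δ) h2 ?_
  change (1 / (2 * regNorm δ z)) • 2 • innerSL ℝ z = _
  have := regNorm_pos hδ z
  ext v
  simp
  field_simp

/-- The exponent grows by two: once from differentiating `s⁻ⁿ`, once from `∇s = z / s`. -/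
theorem hasFDerivAt_regNorm_inv_pow {δ : ℝ} (hδ : 0 < δ) (n : ℕ) (z : E3) :
    HasFDerivAt (fun z => ((regNorm δ z)⁻¹) ^ n)
      (-(n : ℝ) • ((regNorm δ z)⁻¹) ^ (n + 2) • innerSL ℝ z) z := by
  have hp := regNorm_pos hδ z
  have h := ((hasDerivAt_inv hp.ne').pow n).comp_hasFDerivAt z (hasFDerivAt_regNorm hδ z)
  refine HasFDerivAt.congr_fderiv h ?_
  ext v
  rcases n with _ | n
  · simp
  · simp
    field_simp
    ring

/-- The derivative of `s⁻ⁿ`, centred at `a`. -/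
theorem isMultiplier_regNorm {δ : ℝ} (hδ : 0 < δ) (n : ℕ) (a : E3) (k : Fin 3) :
    IsMultiplier k (fun x => (regNorm δ (x - a))⁻¹ ^ n)
      (fun x => -(n : ℝ) * (x - a) k * (regNorm δ (x - a))⁻¹ ^ (n + 2)) := by
  have hc : Continuous fun x => (regNorm δ (x - a))⁻¹ :=
    ((continuous_regNorm δ).comp (continuous_id.sub continuous_const)).inv₀
      fun x => (regNorm_pos hδ _).ne'
  have hb : ∀ x, (regNorm δ (x - a))⁻¹ ≤ δ⁻¹ := fun x => inv_anti₀ hδ (le_regNorm δ _)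
  have h0 : ∀ x, 0 ≤ (regNorm δ (x - a))⁻¹ := fun x => (inv_pos.2 (regNorm_pos hδ _)).le
  refine ⟨hc.pow n, by fun_prop, ⟨δ⁻¹ ^ n, fun x => ?_⟩, ⟨n * δ⁻¹ ^ (n + 1), fun x => ?_⟩,
    fun x => ?_⟩
  · rw [abs_of_nonneg (pow_nonneg (h0 x) n)]
    exact pow_le_pow_left₀ (h0 x) (hb x) n
  · have h1 : |(x - a) k| * (regNorm δ (x - a))⁻¹ ≤ 1 := by
      rw [← div_eq_mul_inv]
      exact div_le_one_of_le₀ ((abs_coord_le_norm _ k).trans (norm_le_regNorm δ _))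
        (regNorm_pos hδ _).le
    calc |-(n : ℝ) * (x - a) k * (regNorm δ (x - a))⁻¹ ^ (n + 2)|
        = n * ((|(x - a) k| * (regNorm δ (x - a))⁻¹) * (regNorm δ (x - a))⁻¹ ^ (n + 1)) := by
          rw [abs_mul, abs_mul, abs_neg, Nat.abs_cast, abs_of_nonneg (pow_nonneg (h0 x) _)]
          ring
      _ ≤ n * (1 * δ⁻¹ ^ (n + 1)) := by
          have := pow_nonneg (h0 x) (n + 1)
          have := pow_le_pow_left₀ (h0 x) (hb x) (n + 1)
          gcongr
      _ = _ := by ring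
  · have h := (hasFDerivAt_regNorm_inv_pow hδ n (x - a)).comp x
      ((hasFDerivAt_id x).sub_const a)
    have hv : -(n : ℝ) * (x - a) k * (regNorm δ (x - a))⁻¹ ^ (n + 2) =
        ((-(n : ℝ) • ((regNorm δ (x - a))⁻¹) ^ (n + 2) • innerSL ℝ (x - a)).comp
          (ContinuousLinearMap.id ℝ E3)) (e k) := by
      simp only [ContinuousLinearMap.comp_apply, smul_apply, innerSL_apply_apply,
        ContinuousLinearMap.id_apply, inner_e, smul_eq_mul]
      ring
    rw [hv]
    exact h.hasLineDerivAt (e k)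

/-- The derivative of `zₖ s⁻ⁿ`, centred at `a`. -/
theorem isMultiplier_coord_regNorm {δ : ℝ} (hδ : 0 < δ) (n : ℕ) (a : E3) (k : Fin 3) :
    IsMultiplier k (fun x => (x - a) k * (regNorm δ (x - a))⁻¹ ^ (n + 1))
      (fun x => (regNorm δ (x - a))⁻¹ ^ (n + 1) -
        (n + 1) * (x - a) k ^ 2 * (regNorm δ (x - a))⁻¹ ^ (n + 3)) := by
  have hc : Continuous fun x => (regNorm δ (x - a))⁻¹ :=
    ((continuous_regNorm δ).comp (continuous_id.sub continuous_const)).inv₀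
      fun x => (regNorm_pos hδ _).ne'
  have hb : ∀ x, (regNorm δ (x - a))⁻¹ ≤ δ⁻¹ := fun x => inv_anti₀ hδ (le_regNorm δ _)
  have h0 : ∀ x, 0 ≤ (regNorm δ (x - a))⁻¹ := fun x => (inv_pos.2 (regNorm_pos hδ _)).le
  have h1 : ∀ x : E3, |(x - a) k| * (regNorm δ (x - a))⁻¹ ≤ 1 := fun x => by
    rw [← div_eq_mul_inv]
    exact div_le_one_of_le₀ ((abs_coord_le_norm _ k).trans (norm_le_regNorm δ _))
      (regNorm_pos hδ _).le
  -- One of the `n + 1` factors `s⁻¹` absorbs the coordinate, since `|zₖ| ≤ s`; the others are at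
  -- most `δ⁻¹`.
  refine ⟨by fun_prop, by fun_prop, ⟨δ⁻¹ ^ n, fun x => ?_⟩,
    ⟨δ⁻¹ ^ (n + 1) + (n + 1) * δ⁻¹ ^ (n + 1), fun x => ?_⟩, fun x => ?_⟩
  · calc |(x - a) k * (regNorm δ (x - a))⁻¹ ^ (n + 1)|
        = (|(x - a) k| * (regNorm δ (x - a))⁻¹) * (regNorm δ (x - a))⁻¹ ^ n := by
          rw [abs_mul, abs_of_nonneg (pow_nonneg (h0 x) _)]
          ring
      _ ≤ 1 * δ⁻¹ ^ n := by
          have := pow_nonneg (h0 x) n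
          have := pow_le_pow_left₀ (h0 x) (hb x) n
          have := h1 x
          gcongr
      _ = _ := by ring
  · refine (abs_sub _ _).trans (add_le_add ?_ ?_)
    · rw [abs_of_nonneg (pow_nonneg (h0 x) _)]
      exact pow_le_pow_left₀ (h0 x) (hb x) _
    · calc |((n : ℝ) + 1) * (x - a) k ^ 2 * (regNorm δ (x - a))⁻¹ ^ (n + 3)|
          = (n + 1) * ((|(x - a) k| * (regNorm δ (x - a))⁻¹) ^ 2 *
              (regNorm δ (x - a))⁻¹ ^ (n + 1)) := by
            rw [abs_mul, abs_mul, abs_of_nonneg (pow_nonneg (h0 x) _), abs_pow,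
              abs_of_nonneg (by positivity : (0 : ℝ) ≤ n + 1)]
            ring
        _ ≤ (n + 1) * (1 ^ 2 * δ⁻¹ ^ (n + 1)) := by
            have h2 : 0 ≤ |(x - a) k| * (regNorm δ (x - a))⁻¹ := mul_nonneg (abs_nonneg _) (h0 x)
            have h3 := pow_nonneg (h0 x) (n + 1)
            have h4 := pow_le_pow_left₀ (h0 x) (hb x) (n + 1)
            have h5 := h1 x
            gcongr
        _ = _ := by ring
  · have h := (hasFDerivAt_regNorm_inv_pow hδ (n + 1) (x - a)).comp x
      ((hasFDerivAt_id x).sub_const a)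
    have hk : HasFDerivAt (fun x : E3 => (x - a) k)
        (EuclideanSpace.proj k : E3 →L[ℝ] ℝ) x := by
      have := (EuclideanSpace.proj (𝕜 := ℝ) k : E3 →L[ℝ] ℝ).hasFDerivAt (x := x)
      exact this.sub_const (a k)
    have h' := (hk.mul h).hasLineDerivAt (e k)
    refine h'.congr_deriv ?_
    simp only [add_apply, ContinuousLinearMap.comp_apply,
      smul_apply, innerSL_apply_apply, ContinuousLinearMap.id_apply, inner_e,
      smul_eq_mul, Function.comp_apply, id_eq]
    have h1 : (EuclideanSpace.proj k : E3 →L[ℝ] ℝ) (e k) = 1 := by simp [e]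
    rw [h1]
    push_cast
    ring

/-! ### Hardy's inequality -/

theorem integrable_norm_sq (u : HL) : Integrable fun x => ‖u x‖ ^ 2 :=
  (memLp_two_iff_integrable_sq_norm (Lp.aestronglyMeasurable u)).1 (Lp.memLp u)

theorem integral_norm_sq (u : HL) : ∫ x, ‖u x‖ ^ 2 = ‖u‖ ^ 2 := by
  have h : ((‖u‖ ^ 2 : ℝ) : ℂ) = ((∫ x, ‖u x‖ ^ 2 : ℝ) : ℂ) := by
    have h1 : inner ℂ u u = ((‖u‖ ^ 2 : ℝ) : ℂ) := by
      rw [inner_self_eq_norm_sq_to_K]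
      norm_cast
    rw [← integral_complex_ofReal, ← h1, L2.inner_def]
    refine integral_congr_ae (ae_of_all _ fun x => ?_)
    simp only [inner_self_eq_norm_sq_to_K]
    norm_cast
  exact_mod_cast h.symm

theorem regNorm_inv_nonneg (δ : ℝ) (z : E3) : 0 ≤ (regNorm δ z)⁻¹ :=
  inv_nonneg.2 (Real.sqrt_nonneg _)

theorem norm_mul_regNorm_inv_le {δ : ℝ} (hδ : 0 < δ) (z : E3) : ‖z‖ * (regNorm δ z)⁻¹ ≤ 1 := by
  rw [← div_eq_mul_inv]
  exact div_le_one_of_le₀ (norm_le_regNorm δ _) (regNorm_pos hδ _).le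

/-- The integration by parts behind Hardy's inequality. -/
theorem H1Approx.ibp_norm_sq {u : HL} {g : Fin 3 → HL} (hu : H1Approx u g) {k : Fin 3}
    {ψ ψ' : E3 → ℝ} (hψ : IsMultiplier k ψ ψ') :
    ∫ x, ψ' x * ‖u x‖ ^ 2 = -∫ x, ψ x * (2 * (inner ℂ (u x) (g k x)).re) := by
  have h := (hu.hasWeakDeriv hu (ContinuousLinearMap.id ℂ C2) k).ibp ψ ψ' hψ
  have e1 : ∀ x, (ψ' x : ℂ) * inner ℂ (u x) ((ContinuousLinearMap.id ℂ C2) (u x)) =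
      ((ψ' x * ‖u x‖ ^ 2 : ℝ) : ℂ) := fun x => by
    rw [ContinuousLinearMap.id_apply, inner_self_eq_norm_sq_to_K]
    push_cast
    rfl
  have e2 : ∀ x, (ψ x : ℂ) * (inner ℂ (g k x) ((ContinuousLinearMap.id ℂ C2) (u x)) +
      inner ℂ (u x) ((ContinuousLinearMap.id ℂ C2) (g k x))) =
      ((ψ x * (2 * (inner ℂ (u x) (g k x)).re) : ℝ) : ℂ) := fun x => by
    rw [ContinuousLinearMap.id_apply, ContinuousLinearMap.id_apply, ← inner_conj_symm (g k x) (u x),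
      add_comm, Complex.add_conj]
    push_cast
    ring
  simp only [e1, e2] at h
  rw [integral_complex_ofReal, integral_complex_ofReal] at h
  exact_mod_cast h

/-- The divergence of `z / s²` in dimension three is `3 s⁻² - 2|z|² s⁻⁴`, and `|z| ≤ s`. -/
theorem sum_deriv_hardy_le {δ : ℝ} (hδ : 0 < δ) (z : E3) :
    (regNorm δ z)⁻¹ ^ 2 ≤
      ∑ k, ((regNorm δ z)⁻¹ ^ 2 - 2 * z k ^ 2 * (regNorm δ z)⁻¹ ^ 4) := by
  have h1 : ∑ k, ((regNorm δ z)⁻¹ ^ 2 - 2 * z k ^ 2 * (regNorm δ z)⁻¹ ^ 4) =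
      3 * (regNorm δ z)⁻¹ ^ 2 - 2 * (‖z‖ * (regNorm δ z)⁻¹) ^ 2 * (regNorm δ z)⁻¹ ^ 2 := by
    rw [Finset.sum_sub_distrib, ← Finset.sum_mul, ← Finset.mul_sum, sum_coord_sq]
    simp
    ring
  have h2 : (‖z‖ * (regNorm δ z)⁻¹) ^ 2 ≤ 1 :=
    pow_le_one₀ (mul_nonneg (norm_nonneg _) (regNorm_inv_nonneg _ _)) (norm_mul_regNorm_inv_le hδ z)
  rw [h1]
  nlinarith [sq_nonneg (regNorm δ z)⁻¹]

/-- Integrating `|u|²` against the divergence of the field `z / s²` and moving the derivative onto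
`|u|²` leaves `2 s⁻¹|u||∇u|`, half of which Young's inequality absorbs into the left side. The
resulting constant 12 is not sharp; only its independence of `δ` and `a` matters. -/
theorem H1Approx.hardy_reg {u : HL} {g : Fin 3 → HL} (hu : H1Approx u g) {δ : ℝ} (hδ : 0 < δ)
    (a : E3) : Integrable (fun x => (regNorm δ (x - a))⁻¹ ^ 2 * ‖u x‖ ^ 2) ∧
    ∫ x, (regNorm δ (x - a))⁻¹ ^ 2 * ‖u x‖ ^ 2 ≤ 12 * ∑ k, ‖g k‖ ^ 2 := by
  have hm := fun k => isMultiplier_coord_regNorm hδ 1 a k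
  have hbd : ∀ {ψ : E3 → ℝ}, Continuous ψ → (∃ C, ∀ x, |ψ x| ≤ C) → ∀ {f : E3 → ℝ},
      Integrable f → Integrable fun x => ψ x * f x := fun hψ ⟨C, hC⟩ _ hf =>
    hf.bdd_mul hψ.aestronglyMeasurable (c := C) (ae_of_all _ hC)
  have hI : Integrable (fun x => (regNorm δ (x - a))⁻¹ ^ 2 * ‖u x‖ ^ 2) :=
    hbd (isMultiplier_regNorm hδ 2 a 0).continuous (isMultiplier_regNorm hδ 2 a 0).bounded
      (integrable_norm_sq u)
  refine ⟨hI, ?_⟩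
  have hre : ∀ k, Integrable fun x => 2 * (inner ℂ (u x) (g k x)).re := fun k =>
    ((L2.integrable_inner (𝕜 := ℂ) u (g k)).re).const_mul 2
  have hL : ∫ x, (regNorm δ (x - a))⁻¹ ^ 2 * ‖u x‖ ^ 2 ≤
      ∑ k, ∫ x, ((regNorm δ (x - a))⁻¹ ^ (1 + 1) -
        ((1 : ℕ) + 1) * (x - a) k ^ 2 * (regNorm δ (x - a))⁻¹ ^ (1 + 3)) * ‖u x‖ ^ 2 := by
    rw [← integral_finsetSum _ fun k _ => hbd (hm k).continuous_deriv (hm k).bounded_deriv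
      (integrable_norm_sq u)]
    refine integral_mono hI (integrable_finsetSum _ fun k _ => hbd (hm k).continuous_deriv
      (hm k).bounded_deriv (integrable_norm_sq u)) fun x => ?_
    simp only [← Finset.sum_mul]
    refine mul_le_mul_of_nonneg_right ?_ (sq_nonneg _)
    refine (sum_deriv_hardy_le hδ (x - a)).trans (le_of_eq ?_)
    norm_num
  -- Young's inequality `2AB ≤ A²/6 + 6B²` in each coordinate: the three weights `1/6` add up to
  -- `1/2 < 1`, so the term can be absorbed.
  have hR : ∑ k, ∫ x, ((regNorm δ (x - a))⁻¹ ^ (1 + 1) -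
        ((1 : ℕ) + 1) * (x - a) k ^ 2 * (regNorm δ (x - a))⁻¹ ^ (1 + 3)) * ‖u x‖ ^ 2 ≤
      ∑ k, ∫ x, (1 / 6 * ((regNorm δ (x - a))⁻¹ ^ 2 * ‖u x‖ ^ 2) + 6 * ‖g k x‖ ^ 2) := by
    refine Finset.sum_le_sum fun k _ => ?_
    rw [hu.ibp_norm_sq (hm k), ← integral_neg]
    refine integral_mono (hbd (hm k).continuous (hm k).bounded (hre k)).neg
      ((hI.const_mul _).add ((integrable_norm_sq (g k)).const_mul _)) fun x => ?_
    have h1 : |(x - a) k * (regNorm δ (x - a))⁻¹ ^ (1 + 1)| ≤ (regNorm δ (x - a))⁻¹ := by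
      rw [abs_mul, abs_of_nonneg (pow_nonneg (regNorm_inv_nonneg _ _) _), pow_succ, pow_one,
        ← mul_assoc]
      refine mul_le_of_le_one_left (regNorm_inv_nonneg _ _) (le_trans ?_
        (norm_mul_regNorm_inv_le hδ (x - a)))
      exact mul_le_mul_of_nonneg_right (abs_coord_le_norm _ k) (regNorm_inv_nonneg _ _)
    have h2 : |(inner ℂ (u x) (g k x)).re| ≤ ‖u x‖ * ‖g k x‖ :=
      (Complex.abs_re_le_norm _).trans (norm_inner_le_norm _ _)
    have h3 : |(x - a) k * (regNorm δ (x - a))⁻¹ ^ (1 + 1) * (2 * (inner ℂ (u x) (g k x)).re)| ≤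
        (regNorm δ (x - a))⁻¹ * (2 * (‖u x‖ * ‖g k x‖)) := by
      rw [abs_mul, abs_mul 2, abs_two]
      gcongr
      exact regNorm_inv_nonneg _ _
    have h4 := neg_abs_le ((x - a) k * (regNorm δ (x - a))⁻¹ ^ (1 + 1) *
      (2 * (inner ℂ (u x) (g k x)).re))
    simp only
    nlinarith [sq_nonneg ((regNorm δ (x - a))⁻¹ * ‖u x‖ - 6 * ‖g k x‖)]
  have hE : ∑ k, ∫ x, (1 / 6 * ((regNorm δ (x - a))⁻¹ ^ 2 * ‖u x‖ ^ 2) + 6 * ‖g k x‖ ^ 2) =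
      1 / 2 * (∫ x, (regNorm δ (x - a))⁻¹ ^ 2 * ‖u x‖ ^ 2) + 6 * ∑ k, ‖g k‖ ^ 2 := by
    simp_rw [fun k => integral_add (hI.const_mul (1 / 6)) ((integrable_norm_sq (g k)).const_mul 6),
      integral_const_mul, integral_norm_sq]
    rw [Finset.sum_add_distrib, Finset.mul_sum]
    simp
    ring
  linarith

/-- The regularisation parameter tending to zero. -/
def regSeq (j : ℕ) : ℝ := 1 / ((j : ℝ) + 1)

theorem regSeq_pos (j : ℕ) : 0 < regSeq j := Nat.one_div_pos_of_nat

theorem tendsto_regSeq : Tendsto regSeq atTop (𝓝 0) := tendsto_one_div_add_atTop_nhds_zero_nat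

theorem tendsto_regNorm_inv {z : E3} (hz : z ≠ 0) :
    Tendsto (fun j => (regNorm (regSeq j) z)⁻¹) atTop (𝓝 (coulomb z)) := by
  have hc : Continuous fun δ : ℝ => regNorm δ z := by
    unfold regNorm
    fun_prop
  have h0 : regNorm 0 z = ‖z‖ := by simp [regNorm]
  have := (hc.tendsto 0).comp tendsto_regSeq
  rw [h0] at this
  exact this.inv₀ (norm_ne_zero_iff.2 hz)

theorem regNorm_inv_le_coulomb (δ : ℝ) {z : E3} (hz : z ≠ 0) :
    (regNorm δ z)⁻¹ ≤ coulomb z :=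
  inv_anti₀ (norm_pos_iff.2 hz) (norm_le_regNorm δ z)

theorem coulomb_nonneg (z : E3) : 0 ≤ coulomb z := inv_nonneg.2 (norm_nonneg z)

theorem ae_sub_ne_zero (a : E3) : ∀ᵐ x : E3, x - a ≠ 0 := by
  filter_upwards [Measure.ae_ne volume a] with x hx
  exact sub_ne_zero.2 hx

@[fun_prop]
theorem measurable_coulomb : Measurable coulomb := measurable_norm.inv

/-- Hardy's inequality, uniformly in the centre. -/
theorem H1Approx.hardy {u : HL} {g : Fin 3 → HL} (hu : H1Approx u g) (a : E3) :
    ∫⁻ x, ENNReal.ofReal (coulomb (x - a) ^ 2 * ‖u x‖ ^ 2) ≤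
      ENNReal.ofReal (12 * ∑ k, ‖g k‖ ^ 2) := by
  have hmeas : ∀ j, AEMeasurable fun x =>
      ENNReal.ofReal ((regNorm (regSeq j) (x - a))⁻¹ ^ 2 * ‖u x‖ ^ 2) := fun j =>
    (hu.hardy_reg (regSeq_pos j) a).1.aestronglyMeasurable.aemeasurable.ennreal_ofReal
  -- Fatou's lemma as the regularisation is removed.
  calc ∫⁻ x, ENNReal.ofReal (coulomb (x - a) ^ 2 * ‖u x‖ ^ 2)
      = ∫⁻ x, liminf (fun j => ENNReal.ofReal ((regNorm (regSeq j) (x - a))⁻¹ ^ 2 * ‖u x‖ ^ 2))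
          atTop := by
        refine lintegral_congr_ae ?_
        filter_upwards [ae_sub_ne_zero a] with x hx
        refine (Tendsto.liminf_eq ?_).symm
        exact (ENNReal.continuous_ofReal.tendsto _).comp
          (((tendsto_regNorm_inv hx).pow 2).mul_const _)
    _ ≤ liminf (fun j => ∫⁻ x, ENNReal.ofReal
          ((regNorm (regSeq j) (x - a))⁻¹ ^ 2 * ‖u x‖ ^ 2)) atTop :=
        lintegral_liminf_le' hmeas
    _ ≤ liminf (fun _ : ℕ => ENNReal.ofReal (12 * ∑ k, ‖g k‖ ^ 2)) atTop := by
        refine liminf_le_liminf (Eventually.of_forall fun j => ?_)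
        rw [← ofReal_integral_eq_lintegral_ofReal (hu.hardy_reg (regSeq_pos j) a).1
          (ae_of_all _ fun x => by positivity)]
        exact ENNReal.ofReal_le_ofReal (hu.hardy_reg (regSeq_pos j) a).2
    _ = _ := by simp

/-! ### Integration by parts against the Coulomb kernel -/

/-- The partial derivative `∂ₖ |z|⁻¹ = -zₖ |z|⁻³` of the Coulomb potential. -/
def coulombDeriv (k : Fin 3) (z : E3) : ℝ := -(z k) * coulomb z ^ 3

@[fun_prop]
theorem measurable_coulombDeriv (k : Fin 3) : Measurable (coulombDeriv k) := by
  unfold coulombDeriv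
  fun_prop

theorem abs_coulombDeriv_le (k : Fin 3) (z : E3) : |coulombDeriv k z| ≤ coulomb z ^ 2 := by
  -- At the origin the product is `0`, because `0⁻¹ = 0`, so no exception is needed.
  have h1 : ‖z‖ * coulomb z ≤ 1 := mul_inv_le_one
  rw [coulombDeriv, abs_mul, abs_neg, abs_of_nonneg (pow_nonneg (coulomb_nonneg z) 3)]
  calc |z k| * coulomb z ^ 3 ≤ ‖z‖ * coulomb z ^ 3 := by
        have := abs_coord_le_norm z k
        have := pow_nonneg (coulomb_nonneg z) 3
        gcongr
    _ = (‖z‖ * coulomb z) * coulomb z ^ 2 := by ring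
    _ ≤ 1 * coulomb z ^ 2 := by
        have := pow_nonneg (coulomb_nonneg z) 2
        gcongr
    _ = _ := one_mul _

theorem abs_coord_mul_regNorm_inv_pow_le {δ : ℝ} (hδ : 0 < δ) (k : Fin 3) {z : E3} (hz : z ≠ 0) :
    |z k * (regNorm δ z)⁻¹ ^ 3| ≤ coulomb z ^ 2 := by
  have h0 := regNorm_inv_nonneg δ z
  have h1 := norm_mul_regNorm_inv_le hδ z
  have h2 := regNorm_inv_le_coulomb δ hz
  rw [abs_mul, abs_of_nonneg (pow_nonneg h0 3)]
  calc |z k| * (regNorm δ z)⁻¹ ^ 3 ≤ ‖z‖ * (regNorm δ z)⁻¹ ^ 3 := by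
        have := abs_coord_le_norm z k
        have := pow_nonneg h0 3
        gcongr
    _ = (‖z‖ * (regNorm δ z)⁻¹) * (regNorm δ z)⁻¹ ^ 2 := by ring
    _ ≤ 1 * coulomb z ^ 2 := by gcongr
    _ = _ := one_mul _

theorem tendsto_coord_mul_regNorm_inv_pow (k : Fin 3) {z : E3} (hz : z ≠ 0) :
    Tendsto (fun j => z k * (regNorm (regSeq j) z)⁻¹ ^ 3) atTop (𝓝 (-coulombDeriv k z)) := by
  have := ((tendsto_regNorm_inv hz).pow 3).const_mul (z k)
  convert this using 2
  simp [coulombDeriv]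

/-- Dominated convergence for the regularised derivative of the Coulomb kernel. -/
theorem tendsto_integral_coord_regNorm (k : Fin 3) (a : E3) {f : E3 → ℂ}
    (hf : AEStronglyMeasurable f) (h2 : Integrable fun x => ((coulomb (x - a) ^ 2 : ℝ) : ℂ) * f x) :
    Tendsto (fun j => ∫ x, (((x - a) k * (regNorm (regSeq j) (x - a))⁻¹ ^ 3 : ℝ) : ℂ) * f x) atTop
      (𝓝 (-∫ x, (coulombDeriv k (x - a) : ℂ) * f x)) := by
  rw [← integral_neg]
  refine tendsto_integral_of_dominated_convergence _ (fun j => ?_) h2.norm (fun j => ?_) ?_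
  · have hc := (isMultiplier_coord_regNorm (regSeq_pos j) 2 a k).continuous
    exact (Complex.continuous_ofReal.comp hc).aestronglyMeasurable.mul hf
  · filter_upwards [ae_sub_ne_zero a] with x hx
    rw [norm_mul, norm_mul]
    refine mul_le_mul_of_nonneg_right ?_ (norm_nonneg _)
    rw [Complex.norm_real, Complex.norm_real, Real.norm_eq_abs, Real.norm_eq_abs, abs_sq]
    exact abs_coord_mul_regNorm_inv_pow_le (regSeq_pos j) k hx
  · filter_upwards [ae_sub_ne_zero a] with x hx
    have := (Complex.continuous_ofReal.tendsto _).comp (tendsto_coord_mul_regNorm_inv_pow k hx)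
    have h3 := this.mul_const (f x)
    simpa only [Function.comp_apply, Complex.ofReal_neg, neg_mul] using h3

/-- Integration by parts against `|x - a|⁻¹`. -/
theorem HasWeakDeriv.integral_coulombDeriv {k : Fin 3} {f f' : E3 → ℂ} (h : HasWeakDeriv k f f')
    (a : E3) (h1 : Integrable fun x => (coulomb (x - a) : ℂ) * f' x)
    (h2 : Integrable fun x => ((coulomb (x - a) ^ 2 : ℝ) : ℂ) * f x) :
    ∫ x, (coulombDeriv k (x - a) : ℂ) * f x = -∫ x, (coulomb (x - a) : ℂ) * f' x := by
  have l1 := (tendsto_integral_coord_regNorm k a h.integrable.aestronglyMeasurable h2).neg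
  rw [neg_neg] at l1
  have l2 : Tendsto (fun j => -∫ x, (((regNorm (regSeq j) (x - a))⁻¹ ^ 1 : ℝ) : ℂ) * f' x) atTop
      (𝓝 (-∫ x, (coulomb (x - a) : ℂ) * f' x)) := by
    refine Tendsto.neg ?_
    refine tendsto_integral_of_dominated_convergence _ (fun j => ?_) h1.norm (fun j => ?_) ?_
    · have hc := (isMultiplier_regNorm (regSeq_pos j) 1 a k).continuous
      exact (Complex.continuous_ofReal.comp hc).aestronglyMeasurable.mul
        h.integrable_deriv.aestronglyMeasurable
    · filter_upwards [ae_sub_ne_zero a] with x hx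
      rw [norm_mul, norm_mul]
      refine mul_le_mul_of_nonneg_right ?_ (norm_nonneg _)
      rw [Complex.norm_real, Complex.norm_real, Real.norm_eq_abs, Real.norm_eq_abs, pow_one,
        abs_of_nonneg (regNorm_inv_nonneg _ _), abs_of_nonneg (coulomb_nonneg _)]
      exact regNorm_inv_le_coulomb _ hx
    · filter_upwards [ae_sub_ne_zero a] with x hx
      simp only [pow_one]
      exact ((Complex.continuous_ofReal.tendsto _).comp (tendsto_regNorm_inv hx)).mul_const (f' x)
  refine tendsto_nhds_unique l1 (l2.congr fun j => ?_)
  -- For `δ > 0` the identity is the integration by parts against `s⁻¹`, whose derivative is `-zₖ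
  -- s⁻³`.
  rw [← h.ibp _ _ (isMultiplier_regNorm (regSeq_pos j) 1 a k), ← integral_neg]
  refine integral_congr_ae (ae_of_all _ fun x => ?_)
  push_cast
  ring

/-! ### The regularised point source -/

/-- The total charge `∫ 3 (1 + |y|²)^{-5/2} dy` of the regularised point source; its value `4π` is
not needed. -/
def pointCharge : ℝ := ∫ y : E3, 3 * (regNorm 1 y)⁻¹ ^ 5

theorem integrable_pointCharge : Integrable fun y : E3 => 3 * (regNorm 1 y)⁻¹ ^ 5 := by
  have h := integrable_rpow_neg_one_add_norm_sq (E := E3) (μ := volume) (r := 5) (by simp; norm_num)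
  refine (h.const_mul 3).congr (ae_of_all _ fun y => ?_)
  have : regNorm 1 y = (1 + ‖y‖ ^ 2) ^ (1 / 2 : ℝ) := by
    rw [← Real.sqrt_eq_rpow, regNorm]
    congr 1
    ring
  simp only [this]
  have hp : 0 ≤ 1 + ‖y‖ ^ 2 := by positivity
  rw [← Real.rpow_neg hp, ← Real.rpow_natCast ((1 + ‖y‖ ^ 2) ^ (-(1 / 2 : ℝ))), ← Real.rpow_mul hp]
  norm_num

theorem pointCharge_pos : 0 < pointCharge := by
  have hpos : ∀ y : E3, 0 < 3 * (regNorm 1 y)⁻¹ ^ 5 := fun y => by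
    have := regNorm_pos one_pos y
    positivity
  refine (integral_pos_iff_support_of_nonneg (fun y => (hpos y).le) integrable_pointCharge).2 ?_
  have : Function.support (fun y : E3 => 3 * (regNorm 1 y)⁻¹ ^ 5) = Set.univ :=
    Set.eq_univ_of_forall fun y => (hpos y).ne'
  rw [this]
  simp

theorem regNorm_smul {δ : ℝ} (hδ : 0 < δ) (y : E3) : regNorm δ (δ • y) = δ * regNorm 1 y := by
  rw [regNorm, regNorm, norm_smul, Real.norm_of_nonneg hδ.le,
    show (δ * ‖y‖) ^ 2 + δ ^ 2 = δ ^ 2 * (‖y‖ ^ 2 + 1 ^ 2) by ring,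
    Real.sqrt_mul (by positivity), Real.sqrt_sq hδ.le]

/-- The substitution `x = δy + a` shows that `3δ² s⁻⁵` is an approximate identity up to its total
mass: the powers `δ³ · δ² · δ⁻⁵` cancel. -/
theorem integral_pointSource_comp {δ : ℝ} (hδ : 0 < δ) (a : E3) (f : E3 → ℂ) :
    ∫ x, ((3 * δ ^ 2 * (regNorm δ (x - a))⁻¹ ^ 5 : ℝ) : ℂ) * f x =
      ∫ y, ((3 * (regNorm 1 y)⁻¹ ^ 5 : ℝ) : ℂ) * f (δ • y + a) := by
  have h1 := integral_sub_right_eq_self (μ := (volume : Measure E3))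
    (fun x => ((3 * δ ^ 2 * (regNorm δ x)⁻¹ ^ 5 : ℝ) : ℂ) * f (x + a)) a
  simp only [sub_add_cancel] at h1
  rw [h1]
  have h2 := Measure.integral_comp_smul_of_nonneg (volume : Measure E3)
    (fun x => ((3 * δ ^ 2 * (regNorm δ x)⁻¹ ^ 5 : ℝ) : ℂ) * f (x + a)) δ (hR := hδ.le)
  have h3 : Module.finrank ℝ E3 = 3 := by simp
  rw [h3] at h2
  have h4 : ∫ x, ((3 * δ ^ 2 * (regNorm δ x)⁻¹ ^ 5 : ℝ) : ℂ) * f (x + a) =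
      (δ ^ 3 : ℝ) • ∫ x, ((3 * δ ^ 2 * (regNorm δ (δ • x))⁻¹ ^ 5 : ℝ) : ℂ) * f (δ • x + a) := by
    rw [h2, smul_smul, mul_inv_cancel₀ (by positivity), one_smul]
  rw [h4, ← integral_smul]
  refine integral_congr_ae (ae_of_all _ fun y => ?_)
  simp only [regNorm_smul hδ, Complex.real_smul, ← mul_assoc, ← Complex.ofReal_mul]
  congr 2
  have := regNorm_pos one_pos y
  field_simp

theorem tendsto_pointSource (a : E3) {f : E3 → ℂ} (hf : Continuous f) (hb : ∃ C, ∀ x, ‖f x‖ ≤ C) :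
    Tendsto (fun j => ∫ x, ((3 * regSeq j ^ 2 * (regNorm (regSeq j) (x - a))⁻¹ ^ 5 : ℝ) : ℂ) * f x)
      atTop (𝓝 (pointCharge * f a)) := by
  obtain ⟨C, hC⟩ := hb
  simp_rw [fun j => integral_pointSource_comp (regSeq_pos j) a f]
  rw [pointCharge, ← integral_complex_ofReal, ← integral_mul_const]
  have hc : Continuous fun y : E3 => 3 * (regNorm 1 y)⁻¹ ^ 5 :=
    continuous_const.mul (((continuous_regNorm 1).inv₀ fun y => (regNorm_pos one_pos y).ne').pow 5)
  refine tendsto_integral_of_dominated_convergence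
    (fun y => 3 * (regNorm 1 y)⁻¹ ^ 5 * C) (fun j => ?_) (integrable_pointCharge.mul_const C)
    (fun j => ae_of_all _ fun y => ?_) (ae_of_all _ fun y => ?_)
  · refine Continuous.aestronglyMeasurable ?_
    exact (Complex.continuous_ofReal.comp hc).mul (hf.comp (by fun_prop))
  · have := regNorm_pos one_pos y
    rw [norm_mul, Complex.norm_real, Real.norm_of_nonneg (by positivity)]
    exact mul_le_mul_of_nonneg_left (hC _) (by positivity)
  · refine Tendsto.const_mul _ ?_
    have h1 : Tendsto (fun j => regSeq j • y + a) atTop (𝓝 ((0 : ℝ) • y + a)) :=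
      (tendsto_regSeq.smul_const y).add_const a
    rw [zero_smul, zero_add] at h1
    exact (hf.tendsto a).comp h1

/-- `-Δ|x - a|⁻¹` is a multiple of the point mass at `a`. -/
theorem sum_integral_coulombDeriv {f cf : E3 → ℂ} {f' : Fin 3 → E3 → ℂ}
    (h : ∀ k, HasWeakDeriv k f (f' k)) (hcf : Continuous cf) (hb : ∃ C, ∀ x, ‖cf x‖ ≤ C)
    (hae : f =ᵐ[volume] cf) (a : E3)
    (h2 : ∀ k, Integrable fun x => ((coulomb (x - a) ^ 2 : ℝ) : ℂ) * f' k x) :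
    ∑ k, ∫ x, (coulombDeriv k (x - a) : ℂ) * f' k x = pointCharge * cf a := by
  have l1 : Tendsto (fun j => ∑ k, -∫ x,
      (((x - a) k * (regNorm (regSeq j) (x - a))⁻¹ ^ 3 : ℝ) : ℂ) * f' k x) atTop
      (𝓝 (∑ k, ∫ x, (coulombDeriv k (x - a) : ℂ) * f' k x)) := by
    refine tendsto_finsetSum _ fun k _ => ?_
    have := (tendsto_integral_coord_regNorm k a
      (h k).integrable_deriv.aestronglyMeasurable (h2 k)).neg
    rwa [neg_neg] at this
  refine tendsto_nhds_unique l1 ((tendsto_pointSource a hcf hb).congr fun j => ?_)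
  have hm := fun k => isMultiplier_coord_regNorm (regSeq_pos j) 2 a k
  -- The divergence of `z s⁻³` is `3 s⁻³ - 3|z|² s⁻⁵ = 3δ² s⁻⁵`, by `s² = |z|² + δ²`.
  calc _ = ∫ x, ∑ k, ((((regNorm (regSeq j) (x - a))⁻¹ ^ (2 + 1) -
        ((2 : ℕ) + 1) * (x - a) k ^ 2 * (regNorm (regSeq j) (x - a))⁻¹ ^ (2 + 3) : ℝ)) : ℂ) *
          f x := by
        refine integral_congr_ae ?_
        filter_upwards [hae] with x hx
        rw [hx, ← Finset.sum_mul, ← Complex.ofReal_sum]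
        congr 2
        rw [Finset.sum_sub_distrib, ← Finset.sum_mul, ← Finset.mul_sum, sum_coord_sq]
        have hs := regNorm_sq (regSeq j) (x - a)
        have hp := regNorm_pos (regSeq_pos j) (x - a)
        simp only [Finset.sum_const, Finset.card_univ, Fintype.card_fin, nsmul_eq_mul]
        have h5 : (regNorm (regSeq j) (x - a))⁻¹ ^ 3 =
            (‖x - a‖ ^ 2 + regSeq j ^ 2) * (regNorm (regSeq j) (x - a))⁻¹ ^ 5 := by
          rw [← hs]
          field_simp
        rw [show 2 + 1 = 3 from rfl, show 2 + 3 = 5 from rfl, h5]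
        push_cast
        ring
    _ = ∑ k, ∫ x, ((((regNorm (regSeq j) (x - a))⁻¹ ^ (2 + 1) -
        ((2 : ℕ) + 1) * (x - a) k ^ 2 * (regNorm (regSeq j) (x - a))⁻¹ ^ (2 + 3) : ℝ)) : ℂ) *
          f x :=
        integral_finsetSum _ fun k _ => integrable_bounded_mul (hm k).continuous_deriv
          (hm k).bounded_deriv (h k).integrable
    _ = _ := Finset.sum_congr rfl fun k _ => (h k).ibp _ _ (hm k)

/-! ### Convolution kernels with a bound that is uniform in the centre -/

/-- `∫ |K(x - a)| |F(x)| dx` is bounded uniformly in `a`. -/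
structure KernelBound (K : E3 → ℝ) (F : E3 → ℂ) : Prop where
  measurable : Measurable K
  aestronglyMeasurable : AEStronglyMeasurable F
  bound : ∃ C : NNReal, ∀ a, ∫⁻ x, ‖(K (x - a) : ℂ) * F x‖ₑ ≤ C

namespace KernelBound

variable {K : E3 → ℝ} {F : E3 → ℂ}

theorem aestronglyMeasurable_mul (h : KernelBound K F) (a : E3) :
    AEStronglyMeasurable fun x => (K (x - a) : ℂ) * F x := by
  have := h.measurable
  exact (Complex.measurable_ofReal.comp
    (h.measurable.comp (measurable_id.sub_const a))).aestronglyMeasurable.mul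
    h.aestronglyMeasurable

theorem integrable (h : KernelBound K F) (a : E3) :
    Integrable fun x => (K (x - a) : ℂ) * F x := by
  obtain ⟨C, hC⟩ := h.bound
  exact ⟨h.aestronglyMeasurable_mul a, (hC a).trans_lt ENNReal.coe_lt_top⟩

theorem exists_norm_integral_le (h : KernelBound K F) :
    ∃ C : ℝ, ∀ a, ∫ x, ‖(K (x - a) : ℂ) * F x‖ ≤ C := by
  obtain ⟨C, hC⟩ := h.bound
  refine ⟨C, fun a => ?_⟩
  rw [integral_norm_eq_lintegral_enorm (h.aestronglyMeasurable_mul a)]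
  exact ENNReal.toReal_le_of_le_ofReal C.2 (by simpa using hC a)

theorem aestronglyMeasurable_prod (h : KernelBound K F) (ν : Measure E3) [SFinite ν] :
    AEStronglyMeasurable (fun p : E3 × E3 => (K (p.1 - p.2) : ℂ) * F p.1)
      ((volume : Measure E3).prod ν) := by
  refine AEStronglyMeasurable.mul ?_ h.aestronglyMeasurable.comp_fst
  exact (Complex.measurable_ofReal.comp
    (h.measurable.comp (measurable_fst.sub measurable_snd))).aestronglyMeasurable

/-- The bound is uniform in the centre, so the iterated integral of the norm is at most a constant
times `∫ |w| dν`. No regularity of `ν` is used, hence singular nuclear charges and point masses are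
covered. -/
theorem integrable_prod (h : KernelBound K F) {ν : Measure E3} [SFinite ν] {w : E3 → ℂ}
    (hw : Integrable w ν) :
    Integrable (fun p : E3 × E3 => w p.2 * ((K (p.1 - p.2) : ℂ) * F p.1))
      ((volume : Measure E3).prod ν) := by
  have hm : AEStronglyMeasurable (fun p : E3 × E3 => w p.2 * ((K (p.1 - p.2) : ℂ) * F p.1))
      ((volume : Measure E3).prod ν) :=
    hw.aestronglyMeasurable.comp_snd.mul (h.aestronglyMeasurable_prod ν)
  rw [integrable_prod_iff' hm]
  refine ⟨ae_of_all _ fun a => (h.integrable a).const_mul (w a), ?_⟩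
  obtain ⟨C, hC⟩ := h.exists_norm_integral_le
  refine (hw.norm.mul_const C).mono ?_ (ae_of_all _ fun a => ?_)
  · exact hm.norm.prod_swap.integral_prod_right'
  · simp only [norm_mul (w a), integral_const_mul]
    rw [norm_mul, norm_mul, norm_norm]
    refine mul_le_mul_of_nonneg_left ?_ (norm_nonneg _)
    rw [Real.norm_of_nonneg (integral_nonneg fun x => norm_nonneg _), Real.norm_eq_abs]
    exact (hC a).trans (le_abs_self C)

/-- A weight times the potential of `F` is integrable. -/
theorem integrable_weight (h : KernelBound K F) {ν : Measure E3} [SFinite ν] {w : E3 → ℂ}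
    (hw : Integrable w ν) : Integrable (fun a => w a * ∫ x, (K (x - a) : ℂ) * F x) ν := by
  have := (h.integrable_prod hw).integral_prod_right
  simpa only [integral_const_mul] using this

theorem integrable_convolution (h : KernelBound K F) {ν : Measure E3} [SFinite ν] {w : E3 → ℂ}
    (hw : Integrable w ν) : Integrable fun x => (∫ a, w a * (K (x - a) : ℂ) ∂ν) * F x := by
  have := (h.integrable_prod hw).integral_prod_left
  simpa only [← mul_assoc, integral_mul_const] using this

/-- Fubini's theorem for the potential of `w dν`. -/
theorem integral_convolution (h : KernelBound K F) {ν : Measure E3} [SFinite ν] {w : E3 → ℂ}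
    (hw : Integrable w ν) : ∫ x, (∫ a, w a * (K (x - a) : ℂ) ∂ν) * F x =
      ∫ a, w a * (∫ x, (K (x - a) : ℂ) * F x) ∂ν := by
  have h1 := integral_integral_swap (f := fun x a => w a * ((K (x - a) : ℂ) * F x))
    (h.integrable_prod hw)
  simp only [integral_const_mul] at h1
  rw [← h1]
  simp only [← mul_assoc, integral_mul_const]

theorem mono (h : KernelBound K F) {K' : E3 → ℝ} (hm : Measurable K') (hK : ∀ z, |K' z| ≤ |K z|) :
    KernelBound K' F := by
  obtain ⟨C, hC⟩ := h.bound
  refine ⟨hm, h.aestronglyMeasurable, C, fun a => (lintegral_mono fun x => ?_).trans (hC a)⟩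
  rw [enorm_mul, enorm_mul]
  gcongr
  rw [enorm_le_iff_norm_le, Complex.norm_real, Complex.norm_real]
  exact hK _

theorem add (h : KernelBound K F) {G : E3 → ℂ} (h' : KernelBound K G) :
    KernelBound K (fun x => F x + G x) := by
  obtain ⟨C, hC⟩ := h.bound
  obtain ⟨C', hC'⟩ := h'.bound
  refine ⟨h.measurable, h.aestronglyMeasurable.add h'.aestronglyMeasurable, C + C', fun a => ?_⟩
  calc ∫⁻ x, ‖(K (x - a) : ℂ) * (F x + G x)‖ₑ
      ≤ ∫⁻ x, (‖(K (x - a) : ℂ) * F x‖ₑ + ‖(K (x - a) : ℂ) * G x‖ₑ) :=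
        lintegral_mono fun x => by rw [mul_add]; exact enorm_add_le _ _
    _ = _ := lintegral_add_left' (h.aestronglyMeasurable_mul a).enorm _
    _ ≤ _ := by push_cast; exact add_le_add (hC a) (hC' a)

theorem const_mul (h : KernelBound K F) (c : ℂ) : KernelBound K (fun x => c * F x) := by
  obtain ⟨C, hC⟩ := h.bound
  refine ⟨h.measurable, h.aestronglyMeasurable.const_mul c, ‖c‖₊ * C, fun a => ?_⟩
  calc ∫⁻ x, ‖(K (x - a) : ℂ) * (c * F x)‖ₑ
      = ∫⁻ x, ‖c‖ₑ * ‖(K (x - a) : ℂ) * F x‖ₑ :=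
        lintegral_congr fun x => by rw [mul_left_comm, enorm_mul]
    _ = ‖c‖ₑ * ∫⁻ x, ‖(K (x - a) : ℂ) * F x‖ₑ := lintegral_const_mul' _ _ enorm_ne_top
    _ ≤ _ := by push_cast; exact mul_le_mul_right (hC a) _

theorem sum {ι : Type*} (s : Finset ι) {F : ι → E3 → ℂ} (hK : Measurable K)
    (h : ∀ i ∈ s, KernelBound K (F i)) : KernelBound K (fun x => ∑ i ∈ s, F i x) := by
  classical
  induction s using Finset.induction_on with
  | empty =>
    simp only [Finset.sum_empty]
    exact ⟨hK, aestronglyMeasurable_const, 0, fun a => by simp⟩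
  | insert i s hi ih =>
    simp only [Finset.sum_insert hi]
    exact (h i (Finset.mem_insert_self i s)).add
      (ih fun j hj => h j (Finset.mem_insert_of_mem hj))

theorem congr (h : KernelBound K F) {G : E3 → ℂ} (hFG : F =ᵐ[volume] G) : KernelBound K G := by
  obtain ⟨C, hC⟩ := h.bound
  refine ⟨h.measurable, h.aestronglyMeasurable.congr hFG, C, fun a => (le_of_eq ?_).trans (hC a)⟩
  refine lintegral_congr_ae ?_
  filter_upwards [hFG] with x hx
  rw [hx]

end KernelBound

/-- Here `W|u||w| ≤ W²|u|² + |w|²`, so Hardy's inequality is needed for one factor only and `w` may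
be any `L²` function, such as a second derivative. -/
theorem H1Approx.kernelBound_coulomb {u : HL} {g : Fin 3 → HL} (hu : H1Approx u g) (w : HL)
    {F : E3 → ℂ} (hF : AEStronglyMeasurable F) (C : ℝ)
    (hb : ∀ᵐ x, ‖F x‖ ≤ C * (‖u x‖ * ‖w x‖)) : KernelBound coulomb F := by
  refine ⟨measurable_coulomb, hF,
    (‖C‖₊ * (Real.toNNReal (12 * ∑ k, ‖g k‖ ^ 2) + Real.toNNReal (‖w‖ ^ 2))), fun a => ?_⟩
  calc ∫⁻ x, ‖(coulomb (x - a) : ℂ) * F x‖ₑ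
      ≤ ∫⁻ x, ‖C‖ₑ * (ENNReal.ofReal (coulomb (x - a) ^ 2 * ‖u x‖ ^ 2) +
          ENNReal.ofReal (‖w x‖ ^ 2)) := by
        refine lintegral_mono_ae ?_
        filter_upwards [hb] with x hx
        rw [← ENNReal.ofReal_add (by positivity) (by positivity), ← ofReal_norm,
          ← ofReal_norm, ← ENNReal.ofReal_mul (norm_nonneg _)]
        refine ENNReal.ofReal_le_ofReal ?_
        have hc := coulomb_nonneg (x - a)
        rw [norm_mul, Complex.norm_real, Real.norm_of_nonneg hc]
        have h1 : ‖F x‖ ≤ ‖C‖ * (‖u x‖ * ‖w x‖) :=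
          hx.trans (mul_le_mul_of_nonneg_right (le_abs_self C) (by positivity))
        calc coulomb (x - a) * ‖F x‖ ≤ coulomb (x - a) * (‖C‖ * (‖u x‖ * ‖w x‖)) := by gcongr
          _ = ‖C‖ * (coulomb (x - a) * ‖u x‖ * ‖w x‖) := by ring
          _ ≤ _ := by
            gcongr
            nlinarith [sq_nonneg (coulomb (x - a) * ‖u x‖ - ‖w x‖),
              sq_nonneg (coulomb (x - a) * ‖u x‖), sq_nonneg ‖w x‖]
    _ = ‖C‖ₑ * ((∫⁻ x, ENNReal.ofReal (coulomb (x - a) ^ 2 * ‖u x‖ ^ 2)) +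
          ∫⁻ x, ENNReal.ofReal (‖w x‖ ^ 2)) := by
        rw [lintegral_const_mul' _ _ enorm_ne_top, lintegral_add_right']
        exact (integrable_norm_sq w).aestronglyMeasurable.aemeasurable.ennreal_ofReal
    _ ≤ _ := by
        push_cast
        rw [← ofReal_integral_eq_lintegral_ofReal (integrable_norm_sq w)
          (ae_of_all _ fun x => sq_nonneg _), integral_norm_sq]
        exact mul_le_mul_right (add_le_add (hu.hardy a) le_rfl) _

/-- For the singularity `|z|⁻²` of `∇W` each factor has to absorb one power of `W`, so Hardy's
inequality is applied to both. -/
theorem H1Approx.kernelBound_coulomb_sq {u w : HL} {g h : Fin 3 → HL} (hu : H1Approx u g)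
    (hw : H1Approx w h) {F : E3 → ℂ} (hF : AEStronglyMeasurable F) (C : ℝ)
    (hb : ∀ᵐ x, ‖F x‖ ≤ C * (‖u x‖ * ‖w x‖)) : KernelBound (fun z => coulomb z ^ 2) F := by
  refine ⟨measurable_coulomb.pow_const 2, hF, (‖C‖₊ * (Real.toNNReal (12 * ∑ k, ‖g k‖ ^ 2) +
    Real.toNNReal (12 * ∑ k, ‖h k‖ ^ 2))), fun a => ?_⟩
  have hmeas : AEMeasurable fun x => ENNReal.ofReal (coulomb (x - a) ^ 2 * ‖w x‖ ^ 2) := by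
    have h1 : Measurable fun x : E3 => coulomb (x - a) := by fun_prop
    have h2 : AEMeasurable fun x => ‖w x‖ := (Lp.aestronglyMeasurable w).norm.aemeasurable
    fun_prop
  calc ∫⁻ x, ‖((coulomb (x - a) ^ 2 : ℝ) : ℂ) * F x‖ₑ
      ≤ ∫⁻ x, ‖C‖ₑ * (ENNReal.ofReal (coulomb (x - a) ^ 2 * ‖u x‖ ^ 2) +
          ENNReal.ofReal (coulomb (x - a) ^ 2 * ‖w x‖ ^ 2)) := by
        refine lintegral_mono_ae ?_
        filter_upwards [hb] with x hx
        rw [← ENNReal.ofReal_add (by positivity) (by positivity), ← ofReal_norm,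
          ← ofReal_norm, ← ENNReal.ofReal_mul (norm_nonneg _)]
        refine ENNReal.ofReal_le_ofReal ?_
        have hc := sq_nonneg (coulomb (x - a))
        rw [norm_mul, Complex.norm_real, Real.norm_of_nonneg hc]
        have h1 : ‖F x‖ ≤ ‖C‖ * (‖u x‖ * ‖w x‖) :=
          hx.trans (mul_le_mul_of_nonneg_right (le_abs_self C) (by positivity))
        calc coulomb (x - a) ^ 2 * ‖F x‖ ≤ coulomb (x - a) ^ 2 * (‖C‖ * (‖u x‖ * ‖w x‖)) := by
              gcongr
          _ = ‖C‖ * (coulomb (x - a) ^ 2 * (‖u x‖ * ‖w x‖)) := by ring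
          _ ≤ ‖C‖ * (coulomb (x - a) ^ 2 * (‖u x‖ ^ 2 + ‖w x‖ ^ 2)) := by
            gcongr
            nlinarith [sq_nonneg (‖u x‖ - ‖w x‖), sq_nonneg ‖u x‖, sq_nonneg ‖w x‖]
          _ = _ := by ring
    _ = ‖C‖ₑ * ((∫⁻ x, ENNReal.ofReal (coulomb (x - a) ^ 2 * ‖u x‖ ^ 2)) +
          ∫⁻ x, ENNReal.ofReal (coulomb (x - a) ^ 2 * ‖w x‖ ^ 2)) := by
        rw [lintegral_const_mul' _ _ enorm_ne_top, lintegral_add_right' _ hmeas]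
    _ ≤ _ := by
        push_cast
        exact mul_le_mul_right (add_le_add (hu.hardy a) (hw.hardy a)) _

theorem KernelBound.coulombDeriv {F : E3 → ℂ} (h : KernelBound (fun z => coulomb z ^ 2) F)
    (k : Fin 3) : KernelBound (coulombDeriv k) F :=
  h.mono (measurable_coulombDeriv k) fun z => (abs_coulombDeriv_le k z).trans (le_abs_self _)

theorem norm_inner_clm_le (M : C2 →L[ℂ] C2) (v w : C2) :
    ‖inner ℂ v (M w)‖ ≤ ‖M‖ * (‖v‖ * ‖w‖) := by
  calc ‖inner ℂ v (M w)‖ ≤ ‖v‖ * ‖M w‖ := norm_inner_le_norm _ _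
    _ ≤ ‖v‖ * (‖M‖ * ‖w‖) := by gcongr; exact M.le_opNorm w
    _ = _ := by ring

theorem H1Approx.kernelBound_inner {u : HL} {g : Fin 3 → HL} (hu : H1Approx u g) (w : HL)
    (M : C2 →L[ℂ] C2) : KernelBound coulomb fun x => inner ℂ (u x) (M (w x)) :=
  hu.kernelBound_coulomb w (integrable_inner_clm M u w).aestronglyMeasurable ‖M‖
    (ae_of_all _ fun _ => norm_inner_clm_le M _ _)

theorem H1Approx.kernelBound_sq_inner {u w : HL} {g h : Fin 3 → HL} (hu : H1Approx u g)
    (hw : H1Approx w h) (M : C2 →L[ℂ] C2) :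
    KernelBound (fun z => coulomb z ^ 2) fun x => inner ℂ (u x) (M (w x)) :=
  hu.kernelBound_coulomb_sq hw (integrable_inner_clm M u w).aestronglyMeasurable ‖M‖
    (ae_of_all _ fun _ => norm_inner_clm_le M _ _)

/-! ### Potentials of compactly supported functions -/

/-- A spinor cut-off function for a compact set. -/
theorem exists_schwartz_cutoff {s : Set E3} (hs : IsCompact s) :
    ∃ χ : 𝓢(E3, C2), ∀ x ∈ s, ‖χ x‖ = 1 := by
  obtain ⟨R, hR, hsR⟩ := hs.isBounded.subset_closedBall_lt 0 0
  let b : ContDiffBump (0 : E3) := ⟨R, R + 1, hR, by linarith⟩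
  let c : C2 := EuclideanSpace.single 0 1
  have h1 : HasCompactSupport fun x : E3 => (b x : ℝ) • c := b.hasCompactSupport.smul_right
  have h2 : ContDiff ℝ ∞ fun x : E3 => (b x : ℝ) • c := b.contDiff.smul contDiff_const
  refine ⟨h1.toSchwartzMap h2, fun x hx => ?_⟩
  have h3 : b x = 1 := b.one_of_mem_closedBall (hsR hx)
  simp [h3, c]

/-- Bounded functions of compact support have uniformly bounded potentials. -/
theorem kernelBound_of_compact {F : E3 → ℂ} (hF : AEStronglyMeasurable F) (C : ℝ)
    (hC : ∀ x, ‖F x‖ ≤ C) {s : Set E3} (hs : IsCompact s) (h0 : ∀ x ∉ s, F x = 0) :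
    KernelBound coulomb F ∧ KernelBound (fun z => coulomb z ^ 2) F := by
  -- Since `|F| ≤ C|χ|²`, Hardy's inequality for `χ` replaces a direct estimate of `∫ |x - a|⁻²`
  -- over `s`.
  obtain ⟨χ, hχ⟩ := exists_schwartz_cutoff hs
  have hb : ∀ᵐ x, ‖F x‖ ≤ C * (‖schwartzL2 χ x‖ * ‖schwartzL2 χ x‖) := by
    filter_upwards [schwartzL2_coe χ] with x hx
    rw [hx]
    by_cases hxs : x ∈ s
    · simpa [hχ x hxs] using hC x
    · have : 0 ≤ C := (norm_nonneg _).trans (hC x)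
      rw [h0 x hxs, norm_zero]
      positivity
  exact ⟨(H1Approx.of_schwartz χ).kernelBound_coulomb _ hF C hb,
    (H1Approx.of_schwartz χ).kernelBound_coulomb_sq (H1Approx.of_schwartz χ) hF C hb⟩

theorem kernelBound_of_hasCompactSupport {f : E3 → ℝ} (hf : Continuous f)
    (hc : HasCompactSupport f) : KernelBound coulomb (fun x => (f x : ℂ)) ∧
      KernelBound (fun z => coulomb z ^ 2) (fun x => (f x : ℂ)) := by
  obtain ⟨C, hC⟩ := hc.exists_bound_of_continuous hf
  refine kernelBound_of_compact (Complex.continuous_ofReal.comp hf).aestronglyMeasurable C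
    (fun x => by simpa using hC x) hc fun x hx => ?_
  simp [image_eq_zero_of_notMem_tsupport hx]

/-! ### Potentials of pairs of finite measures -/

/-- The convolution `-K * ν₁ + K * ν₂`. -/
def pairPot (K : E3 → ℝ) (ν₁ ν₂ : Measure E3) (x : E3) : ℝ :=
  -(∫ y, K (x - y) ∂ν₁) + ∫ y, K (x - y) ∂ν₂

/-- The integral against `-ν₁ + ν₂`. -/
def pairIntegral (ν₁ ν₂ : Measure E3) (f : E3 → ℂ) : ℂ := -(∫ a, f a ∂ν₁) + ∫ a, f a ∂ν₂

section pair

variable {K : E3 → ℝ} {F : E3 → ℂ} (ν₁ ν₂ : Measure E3)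

/-- The inert factor `1` plays the weight `w` in `KernelBound.integral_convolution`; it is
integrable because the measures are finite. -/
theorem ofReal_pairPot (x : E3) : (pairPot K ν₁ ν₂ x : ℂ) =
    -(∫ y, (1 : ℂ) * (K (x - y) : ℂ) ∂ν₁) + ∫ y, (1 : ℂ) * (K (x - y) : ℂ) ∂ν₂ := by
  simp only [one_mul, integral_complex_ofReal, pairPot]
  push_cast
  rfl

variable [IsFiniteMeasure ν₁] [IsFiniteMeasure ν₂]

theorem KernelBound.integrable_pairPot (h : KernelBound K F) :
    Integrable fun x => (pairPot K ν₁ ν₂ x : ℂ) * F x := by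
  simp only [ofReal_pairPot, add_mul, neg_mul]
  exact (h.integrable_convolution (integrable_const 1)).neg.add
    (h.integrable_convolution (integrable_const 1))

theorem KernelBound.integral_pairPot (h : KernelBound K F) :
    ∫ x, (pairPot K ν₁ ν₂ x : ℂ) * F x =
      pairIntegral ν₁ ν₂ fun a => ∫ x, (K (x - a) : ℂ) * F x := by
  simp only [ofReal_pairPot, add_mul, neg_mul]
  have h1 : ∀ (ν : Measure E3) [IsFiniteMeasure ν], Integrable fun x =>
      (∫ y, (1 : ℂ) * (K (x - y) : ℂ) ∂ν) * F x := fun ν _ =>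
    h.integrable_convolution (integrable_const 1)
  have h2 := integral_add (h1 ν₁).neg (h1 ν₂)
  simp only [Pi.neg_apply] at h2
  rw [h2, integral_neg, h.integral_convolution (integrable_const 1),
    h.integral_convolution (integrable_const 1)]
  simp [pairIntegral]

/-- By Fubini it suffices that the indicator of a compact set has a bounded potential. -/
theorem locallyIntegrable_pairPot (hK : Measurable K) (hle : (∀ z, |K z| ≤ |coulomb z ^ 2|) ∨
    ∀ z, |K z| ≤ |coulomb z|) : LocallyIntegrable (pairPot K ν₁ ν₂) := by
  refine locallyIntegrable_iff.2 fun s hs => ?_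
  have hF : AEStronglyMeasurable (s.indicator fun _ : E3 => (1 : ℂ)) :=
    (stronglyMeasurable_const.indicator hs.measurableSet).aestronglyMeasurable
  have hb := kernelBound_of_compact hF 1 (fun x => by
    by_cases hx : x ∈ s <;> simp [hx]) hs (fun x hx => by simp [hx])
  have h : KernelBound K (s.indicator fun _ : E3 => (1 : ℂ)) :=
    hle.elim (hb.2.mono hK) (hb.1.mono hK)
  have := (h.integrable_pairPot ν₁ ν₂).re
  rw [← integrable_indicator_iff hs.measurableSet]
  refine this.congr (ae_of_all _ fun x => ?_)
  by_cases hx : x ∈ s <;> simp [hx]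

end pair

/-! ### The weak gradient -/

/-- The gradient of `-ν₁ * |x|⁻¹ + ν₂ * |x|⁻¹`. -/
def pairGrad (ν₁ ν₂ : Measure E3) (x : E3) : E3 :=
  ∑ k, pairPot (coulombDeriv k) ν₁ ν₂ x • e k

theorem pairGrad_apply (ν₁ ν₂ : Measure E3) (x : E3) (k : Fin 3) :
    pairGrad ν₁ ν₂ x k = pairPot (coulombDeriv k) ν₁ ν₂ x := by
  simp [pairGrad, e_apply]

theorem continuous_fderiv_apply {φ : E3 → ℝ} (hφ : ContDiff ℝ ∞ φ) (v : E3) :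
    Continuous fun x => fderiv ℝ φ x v :=
  (hφ.continuous_fderiv (by simp)).clm_apply continuous_const

theorem contDiff_fderiv_apply {φ : E3 → ℝ} (hφ : ContDiff ℝ ∞ φ) (v : E3) :
    ContDiff ℝ ∞ fun x => fderiv ℝ φ x v :=
  (hφ.fderiv_right (m := ∞) (by simp)).clm_apply contDiff_const

theorem integral_coulombDeriv_testFunction {φ : E3 → ℝ} (hφ : ContDiff ℝ ∞ φ)
    (hc : HasCompactSupport φ) (k : Fin 3) (a : E3) :
    ∫ x, (coulombDeriv k (x - a) : ℂ) * (φ x : ℂ) =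
      -∫ x, (coulomb (x - a) : ℂ) * ((fderiv ℝ φ x (e k) : ℝ) : ℂ) :=
  (hasWeakDeriv_testFunction hφ hc k).integral_coulombDeriv a
    ((kernelBound_of_hasCompactSupport (continuous_fderiv_apply hφ (e k))
      (hc.fderiv_apply ℝ (e k))).1.integrable a)
    ((kernelBound_of_hasCompactSupport hφ.continuous hc).2.integrable a)

variable (ν₁ ν₂ : Measure E3)

theorem pairIntegral_neg (f : E3 → ℂ) :
    pairIntegral ν₁ ν₂ (fun a => -f a) = -pairIntegral ν₁ ν₂ f := by
  simp only [pairIntegral, integral_neg]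
  ring

/-- The charge of a measure, as a multiple of the measure. -/
abbrev chargeMeasure (ν : Measure E3) : Measure E3 := pointCharge.toNNReal • ν

/-- Scaling keeps both measures nonnegative, so the sign in `-κ` is produced by interchanging them.
-/
theorem pairIntegral_chargeMeasure (f : E3 → ℂ) :
    pairIntegral (chargeMeasure ν₂) (chargeMeasure ν₁) f =
      -(pointCharge * pairIntegral ν₁ ν₂ f) := by
  simp only [pairIntegral, chargeMeasure, integral_smul_nnreal_measure, NNReal.smul_def,
    Real.coe_toNNReal _ pointCharge_pos.le, Complex.real_smul]
  ring

variable [IsFiniteMeasure ν₁] [IsFiniteMeasure ν₂]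

/-- Fubini reduces the claim to a single centre, where it is integration by parts of a test function
against `|x - a|⁻¹`. -/
theorem isWeakGradient_pairPot :
    IsWeakGradient (pairPot coulomb ν₁ ν₂) (pairGrad ν₁ ν₂) := by
  refine ⟨locallyIntegrable_pairPot ν₁ ν₂ measurable_coulomb (.inr fun _ => le_rfl), ?_, ?_⟩
  · have hk : ∀ k : Fin 3, LocallyIntegrable (pairPot (coulombDeriv k) ν₁ ν₂) := fun k =>
      locallyIntegrable_pairPot ν₁ ν₂ (measurable_coulombDeriv k)
        (.inl fun z => (abs_coulombDeriv_le k z).trans (le_abs_self _))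
    refine locallyIntegrable_iff.2 fun s hs => ?_
    exact integrable_finsetSum _ fun k _ => ((hk k).integrableOn_isCompact hs).smul_const (e k)
  · intro φ hφ hc k
    have hB := kernelBound_of_hasCompactSupport hφ.continuous hc
    have hB' := kernelBound_of_hasCompactSupport (continuous_fderiv_apply hφ (e k))
      (hc.fderiv_apply ℝ (e k))
    have h1 := hB'.1.integral_pairPot ν₁ ν₂
    have h2 := (hB.2.coulombDeriv k).integral_pairPot ν₁ ν₂
    simp only [integral_coulombDeriv_testFunction hφ hc k] at h2
    rw [pairIntegral_neg, ← h1] at h2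
    have h3 : ((∫ x, pairPot coulomb ν₁ ν₂ x * fderiv ℝ φ x (e k) : ℝ) : ℂ) =
        ((-∫ x, pairGrad ν₁ ν₂ x k * φ x : ℝ) : ℂ) := by
      simp only [pairGrad_apply]
      push_cast
      rw [← integral_complex_ofReal, ← integral_complex_ofReal]
      push_cast
      rw [h2, neg_neg]
    exact_mod_cast h3

/-- The gradient is picked by choice. The fundamental lemma of the calculus of variations,
componentwise, identifies it almost everywhere with the explicit one. -/
theorem weakGrad_spec {Φ : E3 → ℝ} {G : E3 → E3} (h : IsWeakGradient Φ G) :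
    IsWeakGradient Φ (weakGrad Φ) ∧ weakGrad Φ =ᵐ[volume] G := by
  have hex : ∃ G, IsWeakGradient Φ G := ⟨G, h⟩
  have hs : IsWeakGradient Φ (weakGrad Φ) := by
    rw [weakGrad, dif_pos hex]
    exact hex.choose_spec
  refine ⟨hs, ?_⟩
  have hcomp : ∀ {H : E3 → E3}, LocallyIntegrable H → ∀ k : Fin 3,
      LocallyIntegrable fun x => H x k := fun hH k => by
    refine locallyIntegrable_iff.2 fun s hsc => ?_
    exact (EuclideanSpace.proj (𝕜 := ℝ) k : E3 →L[ℝ] ℝ).integrable_comp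
      (hH.integrableOn_isCompact hsc)
  have hk : ∀ k : Fin 3, ∀ᵐ x, weakGrad Φ x k = G x k := fun k => by
    refine ae_eq_of_integral_contDiff_smul_eq (hcomp hs.2.1 k) (hcomp h.2.1 k) fun φ hφ hc => ?_
    have h1 := hs.2.2 φ hφ hc k
    have h2 := h.2.2 φ hφ hc k
    simp only [smul_eq_mul, mul_comm (φ _)]
    linarith
  filter_upwards [ae_all_iff.2 hk] with x hx
  ext k
  exact hx k

/-! ### The distributional Laplacian -/

/-- Relative to a common dominating measure both measures have integrable densities, and densities
are determined by test functions. -/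
theorem measure_ext_testFunction_of_ac {E : Type*} [NormedAddCommGroup E] [NormedSpace ℝ E]
    [FiniteDimensional ℝ E] [MeasurableSpace E] [BorelSpace E] {ν₁ ν₂ m : Measure E}
    [IsFiniteMeasure ν₁] [IsFiniteMeasure ν₂] [IsFiniteMeasure m] (a1 : ν₁ ≪ m)
    (a2 : ν₂ ≪ m) (h : ∀ φ : E → ℝ, ContDiff ℝ ∞ φ → HasCompactSupport φ →
      ∫ x, φ x ∂ν₁ = ∫ x, φ x ∂ν₂) : ν₁ = ν₂ := by
  have hae : ∀ᵐ x ∂m, (ν₁.rnDeriv m x).toReal = (ν₂.rnDeriv m x).toReal := by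
    refine ae_eq_of_integral_contDiff_smul_eq
      (Measure.integrable_toReal_rnDeriv (μ := ν₁) (ν := m)).locallyIntegrable
      (Measure.integrable_toReal_rnDeriv (μ := ν₂) (ν := m)).locallyIntegrable fun φ hφ hc => ?_
    have h1 := integral_rnDeriv_smul (f := φ) a1
    have h2 := integral_rnDeriv_smul (f := φ) a2
    simp only [smul_eq_mul] at h1 h2 ⊢
    simp only [mul_comm (φ _)]
    rw [h1, h2, h φ hφ hc]
  rw [← Measure.withDensity_rnDeriv_eq _ _ a1, ← Measure.withDensity_rnDeriv_eq _ _ a2]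
  refine withDensity_congr_ae ?_
  filter_upwards [hae, Measure.rnDeriv_lt_top ν₁ m, Measure.rnDeriv_lt_top ν₂ m] with x hx h1 h2
  exact (ENNReal.toReal_eq_toReal_iff' h1.ne h2.ne).1 hx

/-- Finite measures are determined by their integrals of test functions. -/
theorem measure_ext_testFunction (h : ∀ φ : E3 → ℝ, ContDiff ℝ ∞ φ → HasCompactSupport φ →
    ∫ x, φ x ∂ν₁ = ∫ x, φ x ∂ν₂) : ν₁ = ν₂ :=
  measure_ext_testFunction_of_ac (m := ν₁ + ν₂)
    (Measure.le_add_right le_rfl).absolutelyContinuous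
    (Measure.le_add_left le_rfl).absolutelyContinuous h

theorem integrable_of_continuous_bounded {f : E3 → ℂ} (hf : Continuous f)
    (hb : ∃ C, ∀ x, ‖f x‖ ≤ C) (ν : Measure E3) [IsFiniteMeasure ν] : Integrable f ν := by
  obtain ⟨C, hC⟩ := hb
  exact .of_bound hf.aestronglyMeasurable C (ae_of_all _ hC)

theorem signedIntegrable_of_continuous_bounded {f : E3 → ℂ} (hf : Continuous f)
    (hb : ∃ C, ∀ x, ‖f x‖ ≤ C) (ν : SignedMeasure E3) : SignedIntegrable ν f :=
  ⟨integrable_of_continuous_bounded hf hb _, integrable_of_continuous_bounded hf hb _⟩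

/-- The hypothesis says `ν = ν₂ - ν₁` in terms of positive measures. The Jordan parts may differ
from `ν₂` and `ν₁` by a common summand, which cancels in the integral. -/
theorem signedIntegral_eq_of_add_eq {ν : SignedMeasure E3}
    (h : ν.toJordanDecomposition.posPart + ν₁ = ν.toJordanDecomposition.negPart + ν₂)
    {f : E3 → ℂ} (hf : Continuous f) (hb : ∃ C, ∀ x, ‖f x‖ ≤ C) :
    signedIntegral ν f = pairIntegral ν₁ ν₂ f := by
  have hi : ∀ (m : Measure E3) [IsFiniteMeasure m], Integrable f m := fun m _ =>
    integrable_of_continuous_bounded hf hb m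
  have h1 := congrArg (fun m => ∫ x, f x ∂m) h
  rw [integral_add_measure (hi _) (hi _), integral_add_measure (hi _) (hi _)] at h1
  rw [signedIntegral, pairIntegral]
  linear_combination h1

theorem exists_signedMeasure : ∃ ν : SignedMeasure E3,
    ν.toJordanDecomposition.posPart + ν₁ = ν.toJordanDecomposition.negPart + ν₂ := by
  refine ⟨ν₂.toSignedMeasure - ν₁.toSignedMeasure, ?_⟩
  set ν := ν₂.toSignedMeasure - ν₁.toSignedMeasure with hν
  have h := ν.toSignedMeasure_toJordanDecomposition
  rw [JordanDecomposition.toSignedMeasure, hν, ← hν, sub_eq_sub_iff_add_eq_add] at h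
  rw [← Measure.toSignedMeasure_eq_toSignedMeasure_iff, Measure.toSignedMeasure_add,
    Measure.toSignedMeasure_add, h, add_comm]

theorem laplacian_eq_sum_fderiv {φ : E3 → ℝ} (hφ : ContDiff ℝ ∞ φ) (x : E3) :
    (Δ φ) x = ∑ k, fderiv ℝ (fun y => fderiv ℝ φ y (e k)) x (e k) := by
  rw [InnerProductSpace.laplacian_eq_iteratedFDeriv_orthonormalBasis φ
    (EuclideanSpace.basisFun (Fin 3) ℝ)]
  refine Finset.sum_congr rfl fun k _ => ?_
  rw [iteratedFDeriv_two_apply]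
  have hd : DifferentiableAt ℝ (fderiv ℝ φ) x :=
    ((hφ.fderiv_right (m := ∞) (by simp)).differentiable (by simp)) x
  rw [fderiv_clm_apply hd (differentiableAt_const _)]
  simp [e]

/-- `∫ |x - a|⁻¹ Δφ(x) dx` is a multiple of `φ(a)`. -/
theorem integral_coulomb_laplacian {φ : E3 → ℝ} (hφ : ContDiff ℝ ∞ φ)
    (hc : HasCompactSupport φ) (a : E3) :
    ∫ x, (coulomb (x - a) : ℂ) * (((Δ φ) x : ℝ) : ℂ) = -(pointCharge * (φ a : ℂ)) := by
  have hφk := fun k => contDiff_fderiv_apply hφ (e k)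
  have hck := fun k => hc.fderiv_apply ℝ (e k)
  have hB := fun k => kernelBound_of_hasCompactSupport (continuous_fderiv_apply (hφk k) (e k))
    ((hck k).fderiv_apply ℝ (e k))
  obtain ⟨C, hC⟩ := hc.exists_bound_of_continuous hφ.continuous
  rw [← sum_integral_coulombDeriv (cf := fun x => (φ x : ℂ))
    (fun k => hasWeakDeriv_testFunction hφ hc k)
    (Complex.continuous_ofReal.comp hφ.continuous) ⟨C, fun x => by simpa using hC x⟩
    (ae_eq_refl _) a fun k =>
      (kernelBound_of_hasCompactSupport (hφk k).continuous (hck k)).2.integrable a]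
  simp_rw [fun k => integral_coulombDeriv_testFunction (hφk k) (hck k) k a]
  rw [Finset.sum_neg_distrib, neg_neg, ← integral_finsetSum _ fun k _ => (hB k).1.integrable a]
  refine integral_congr_ae (ae_of_all _ fun x => ?_)
  simp only [laplacian_eq_sum_fderiv hφ x, Complex.ofReal_sum, Finset.mul_sum]

theorem integral_pairPot_laplacian {φ : E3 → ℝ} (hφ : ContDiff ℝ ∞ φ)
    (hc : HasCompactSupport φ) :
    ((∫ x, pairPot coulomb ν₁ ν₂ x * (Δ φ) x : ℝ) : ℂ) =
      -(pointCharge * pairIntegral ν₁ ν₂ fun a => (φ a : ℂ)) := by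
  have hB : KernelBound coulomb fun x => (((Δ φ) x : ℝ) : ℂ) := by
    simp only [laplacian_eq_sum_fderiv hφ, Complex.ofReal_sum]
    refine KernelBound.sum _ measurable_coulomb fun k _ => ?_
    exact (kernelBound_of_hasCompactSupport
      (continuous_fderiv_apply (contDiff_fderiv_apply hφ (e k)) (e k))
      ((hc.fderiv_apply ℝ (e k)).fderiv_apply ℝ (e k))).1
  rw [← integral_complex_ofReal]
  push_cast
  rw [hB.integral_pairPot ν₁ ν₂]
  simp only [integral_coulomb_laplacian hφ hc, pairIntegral, integral_neg, integral_const_mul]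
  ring


theorem isDistribLaplacian_pairPot_of {ν : SignedMeasure E3}
    (h : ν.toJordanDecomposition.posPart + chargeMeasure ν₂ =
      ν.toJordanDecomposition.negPart + chargeMeasure ν₁) :
    IsDistribLaplacian (pairPot coulomb ν₁ ν₂) ν := by
  refine ⟨locallyIntegrable_pairPot ν₁ ν₂ measurable_coulomb (.inr fun _ => le_rfl),
    fun φ hφ hc => ?_⟩
  obtain ⟨C, hC⟩ := hc.exists_bound_of_continuous hφ.continuous
  rw [integral_pairPot_laplacian ν₁ ν₂ hφ hc, signedIntegral_eq_of_add_eq _ _ h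
    (f := fun x => (φ x : ℂ)) (Complex.continuous_ofReal.comp hφ.continuous)
    ⟨C, fun x => by simpa using hC x⟩,
    pairIntegral_chargeMeasure]

/-- Uniqueness: whichever signed measure represents the Laplacian, its tests against smooth
functions force it to be `κ(ν₁ - ν₂)`. -/
theorem add_eq_of_isDistribLaplacian {ν : SignedMeasure E3}
    (h : IsDistribLaplacian (pairPot coulomb ν₁ ν₂) ν) :
    ν.toJordanDecomposition.posPart + chargeMeasure ν₂ =
      ν.toJordanDecomposition.negPart + chargeMeasure ν₁ := by
  refine measure_ext_testFunction _ _ fun φ hφ hc => ?_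
  obtain ⟨C, hC⟩ := hc.exists_bound_of_continuous hφ.continuous
  have hi : ∀ (m : Measure E3) [IsFiniteMeasure m], Integrable φ m := fun m _ =>
    .of_bound hφ.continuous.aestronglyMeasurable C (ae_of_all _ hC)
  have h1 := h.2 φ hφ hc
  rw [integral_pairPot_laplacian ν₁ ν₂ hφ hc, ← pairIntegral_chargeMeasure, pairIntegral,
    signedIntegral] at h1
  simp only [integral_complex_ofReal] at h1
  rw [integral_add_measure (hi _) (hi _), integral_add_measure (hi _) (hi _)]
  have h2 : (((∫ x, φ x ∂ν.toJordanDecomposition.posPart) + ∫ x, φ x ∂chargeMeasure ν₂ : ℝ) : ℂ) =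
      (((∫ x, φ x ∂ν.toJordanDecomposition.negPart) + ∫ x, φ x ∂chargeMeasure ν₁ : ℝ) : ℂ) := by
    push_cast
    linear_combination -h1
  exact_mod_cast h2

/-- Identifying the chosen measure extends its formula from test functions to bounded continuous
functions. This is needed since `u^*v` is in general neither smooth nor compactly supported. -/
theorem distribLaplacian_pairPot :
    IsDistribLaplacian (pairPot coulomb ν₁ ν₂) (distribLaplacian (pairPot coulomb ν₁ ν₂)) ∧
    ∀ {f : E3 → ℂ}, Continuous f → (∃ C, ∀ x, ‖f x‖ ≤ C) →
      signedIntegral (distribLaplacian (pairPot coulomb ν₁ ν₂)) f =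
        -(pointCharge * pairIntegral ν₁ ν₂ f) := by
  obtain ⟨ν, hν⟩ := exists_signedMeasure (chargeMeasure ν₂) (chargeMeasure ν₁)
  have hex : ∃ ν, IsDistribLaplacian (pairPot coulomb ν₁ ν₂) ν :=
    ⟨ν, isDistribLaplacian_pairPot_of ν₁ ν₂ hν⟩
  have hs : IsDistribLaplacian (pairPot coulomb ν₁ ν₂)
      (distribLaplacian (pairPot coulomb ν₁ ν₂)) := by
    rw [distribLaplacian, dif_pos hex]
    exact hex.choose_spec
  refine ⟨hs, fun hf hb => ?_⟩
  rw [signedIntegral_eq_of_add_eq _ _ (add_eq_of_isDistribLaplacian ν₁ ν₂ hs) hf hb,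
    pairIntegral_chargeMeasure]

/-! ### The continuous representative -/

theorem H1Approx.hardy_integral {u : HL} {g : Fin 3 → HL} (hu : H1Approx u g) (a : E3) :
    Integrable (fun x => coulomb (x - a) ^ 2 * ‖u x‖ ^ 2) ∧
      ∫ x, coulomb (x - a) ^ 2 * ‖u x‖ ^ 2 ≤ 12 * ∑ k, ‖g k‖ ^ 2 := by
  have hm : AEStronglyMeasurable fun x => coulomb (x - a) ^ 2 * ‖u x‖ ^ 2 := by
    have h1 : Measurable fun x : E3 => coulomb (x - a) := by fun_prop
    have h2 : AEMeasurable fun x => ‖u x‖ := (Lp.aestronglyMeasurable u).norm.aemeasurable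
    exact AEMeasurable.aestronglyMeasurable (by fun_prop)
  have h0 : 0 ≤ᵐ[volume] fun x => coulomb (x - a) ^ 2 * ‖u x‖ ^ 2 :=
    ae_of_all _ fun x => by positivity
  refine ⟨⟨hm, ?_⟩, ?_⟩
  · rw [hasFiniteIntegral_iff_ofReal h0]
    exact (hu.hardy a).trans_lt ENNReal.ofReal_lt_top
  · rw [integral_eq_lintegral_of_nonneg_ae h0 hm]
    exact ENNReal.toReal_le_of_le_ofReal (by positivity) (hu.hardy a)

/-- The Sobolev embedding in quantitative form: `κ|φ(a)|² = ∫ ∇W · ∇|φ|²`, where `|∂ₖW| ≤ W²` and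
`2|φ||∂ₖφ| ≤ |φ|² + |∂ₖφ|²`. Hardy's inequality for `φ` and for `∂ₖφ` then bounds the integral
uniformly in `a`. -/
theorem schwartz_sup_bound (φ : 𝓢(E3, C2)) (a : E3) :
    pointCharge * ‖φ a‖ ^ 2 ≤ ∑ k, (12 * ∑ l, ‖schwartzL2 (∂_{e l} φ)‖ ^ 2 +
      12 * ∑ l, ‖schwartzL2 (∂_{e l} (∂_{e k} φ))‖ ^ 2) := by
  have hφ := H1Approx.of_schwartz φ
  have hφk := fun k => H1Approx.of_schwartz (∂_{e k} φ)
  let I := ContinuousLinearMap.id ℂ C2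
  obtain ⟨C, hC⟩ : ∃ C, ∀ x, ‖φ x‖ ≤ C :=
    ⟨_, fun x => φ.toBoundedContinuousFunction.norm_coe_le_norm x⟩
  have hw := fun k => hφ.hasWeakDeriv hφ I k
  have key := sum_integral_coulombDeriv (cf := fun x => inner ℂ (φ x) (φ x)) hw
    (φ.continuous.inner φ.continuous) ⟨C * C, fun x => (norm_inner_le_norm _ _).trans
      (mul_le_mul (hC x) (hC x) (norm_nonneg _) ((norm_nonneg _).trans (hC x)))⟩
    (by
      filter_upwards [schwartzL2_coe φ] with x hx
      simp [I, hx]) a fun k => by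
      simp only [mul_add]
      exact (((hφk k).kernelBound_sq_inner hφ I).integrable a).add
        ((hφ.kernelBound_sq_inner (hφk k) I).integrable a)
  have hn : ‖(pointCharge : ℂ) * inner ℂ (φ a) (φ a)‖ = pointCharge * ‖φ a‖ ^ 2 := by
    rw [norm_mul, Complex.norm_real, Real.norm_of_nonneg pointCharge_pos.le,
      inner_self_eq_norm_sq_to_K, norm_pow]
    simp
  rw [← hn, ← key]
  refine (norm_sum_le _ _).trans (Finset.sum_le_sum fun k _ => ?_)
  refine (norm_integral_le_integral_norm _).trans ?_
  have h1 := hφ.hardy_integral a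
  have h2 := (hφk k).hardy_integral a
  refine le_trans (integral_mono_of_nonneg (ae_of_all _ fun x => norm_nonneg _)
    (h1.1.add h2.1) (ae_of_all _ fun x => ?_)) ?_
  · simp only [Pi.add_apply, I, ContinuousLinearMap.id_apply]
    rw [norm_mul, Complex.norm_real, Real.norm_eq_abs, ← mul_add]
    refine mul_le_mul (abs_coulombDeriv_le k _) ?_ (norm_nonneg _) (by positivity)
    have h3 := norm_inner_le_norm (𝕜 := ℂ) (schwartzL2 (∂_{e k} φ) x) (schwartzL2 φ x)
    have h4 := norm_inner_le_norm (𝕜 := ℂ) (schwartzL2 φ x) (schwartzL2 (∂_{e k} φ) x)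
    refine (norm_add_le _ _).trans ?_
    nlinarith [sq_nonneg (‖schwartzL2 φ x‖ - ‖schwartzL2 (∂_{e k} φ) x‖)]
  · rw [integral_add' h1.1 h2.1]
    exact add_le_add h1.2 h2.2

theorem schwartzL2_sub (φ χ : 𝓢(E3, C2)) :
    schwartzL2 (φ - χ) = schwartzL2 φ - schwartzL2 χ :=
  (SchwartzMap.toLpCLM ℂ C2 2 (volume : Measure E3)).map_sub φ χ

theorem lineDeriv_schwartz_sub (k : Fin 3) (φ χ : 𝓢(E3, C2)) :
    ∂_{e k} (φ - χ) = ∂_{e k} φ - ∂_{e k} χ :=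
  (LineDeriv.lineDerivOpCLM ℂ 𝓢(E3, C2) (e k)).map_sub φ χ

theorem schwartz_sup_bound_sub (φ χ : 𝓢(E3, C2)) (a : E3) :
    pointCharge * dist (φ a) (χ a) ^ 2 ≤
      ∑ k, (12 * ∑ l, dist (schwartzL2 (∂_{e l} φ)) (schwartzL2 (∂_{e l} χ)) ^ 2 +
        12 * ∑ l, dist (schwartzL2 (∂_{e l} (∂_{e k} φ)))
          (schwartzL2 (∂_{e l} (∂_{e k} χ))) ^ 2) := by
  have h := schwartz_sup_bound (φ - χ) a
  simp only [lineDeriv_schwartz_sub, schwartzL2_sub, sub_apply] at h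
  simp only [dist_eq_norm]
  exact h

/-- By the sup bound for differences, the Schwartz approximants of `u` form a Cauchy sequence in the
uniform norm. -/
theorem InH2.exists_continuous {u : HL} (hu : InH2 u) :
    ∃ f : E3 → C2, Continuous f ∧ (∃ C, ∀ x, ‖f x‖ ≤ C) ∧ f =ᵐ[volume] u := by
  obtain ⟨-, -, -, -, φ, h0, h1, h2⟩ := hu.exists_approx
  let b : ℕ → BoundedContinuousFunction E3 C2 := fun j => (φ j).toBoundedContinuousFunction
  have hcauchy : CauchySeq b := by
    rw [cauchySeq_iff_tendsto_dist_atTop_0]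
    let Q : ℕ × ℕ → ℝ := fun n => ∑ k, (12 * ∑ l, dist (schwartzL2 (∂_{e l} (φ n.1)))
        (schwartzL2 (∂_{e l} (φ n.2))) ^ 2 +
      12 * ∑ l, dist (schwartzL2 (∂_{e l} (∂_{e k} (φ n.1))))
        (schwartzL2 (∂_{e l} (∂_{e k} (φ n.2)))) ^ 2)
    have hQ : Tendsto Q atTop (𝓝 0) := by
      have e1 : ∀ l, Tendsto (fun n : ℕ × ℕ => dist (schwartzL2 (∂_{e l} (φ n.1)))
          (schwartzL2 (∂_{e l} (φ n.2))) ^ 2) atTop (𝓝 0) := fun l => by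
        simpa using (cauchySeq_iff_tendsto_dist_atTop_0.1 (h1 l).cauchySeq).pow 2
      have e2 : ∀ k l, Tendsto (fun n : ℕ × ℕ => dist (schwartzL2 (∂_{e l} (∂_{e k} (φ n.1))))
          (schwartzL2 (∂_{e l} (∂_{e k} (φ n.2)))) ^ 2) atTop (𝓝 0) := fun k l => by
        simpa using (cauchySeq_iff_tendsto_dist_atTop_0.1 (h2 k l).cauchySeq).pow 2
      have := tendsto_finsetSum Finset.univ fun (k : Fin 3) _ =>
        ((tendsto_finsetSum Finset.univ fun (l : Fin 3) _ => e1 l).const_mul 12).add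
          ((tendsto_finsetSum Finset.univ fun (l : Fin 3) _ => e2 k l).const_mul 12)
      simpa [Q] using this
    have hQ' : Tendsto (fun n => √(Q n / pointCharge)) atTop (𝓝 0) := by
      simpa using (hQ.div_const pointCharge).sqrt
    refine squeeze_zero (fun n => dist_nonneg) (fun n => ?_) hQ'
    refine (BoundedContinuousFunction.dist_le (Real.sqrt_nonneg _)).2 fun x => ?_
    refine Real.le_sqrt_of_sq_le ?_
    rw [le_div_iff₀ pointCharge_pos, mul_comm]
    exact schwartz_sup_bound_sub (φ n.1) (φ n.2) x
  obtain ⟨f, hf⟩ := cauchySeq_tendsto_of_complete hcauchy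
  refine ⟨f, f.continuous, ⟨‖f‖, f.norm_coe_le_norm⟩, ?_⟩
  -- `L²` convergence gives convergence almost everywhere along a subsequence, which identifies the
  -- uniform limit with `u`.
  have hmeas : TendstoInMeasure volume (fun j => (schwartzL2 (φ j) : E3 → C2)) atTop u :=
    tendstoInMeasure_of_tendsto_Lp h0
  obtain ⟨ns, hns, hlim⟩ := hmeas.exists_seq_tendsto_ae
  filter_upwards [hlim, ae_all_iff.2 fun j => schwartzL2_coe (φ j)] with x hx hcoe
  have hfx : Tendsto (fun j => φ (ns j) x) atTop (𝓝 (f x)) :=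
    (((BoundedContinuousFunction.lipschitz_eval_const x).continuous.tendsto f).comp hf).comp
      hns.tendsto_atTop
  simp only [hcoe] at hx
  exact tendsto_nhds_unique hfx hx

theorem InH2.contRep_spec {u : HL} (hu : InH2 u) : Continuous (contRep u) ∧
    (∃ C, ∀ x, ‖contRep u x‖ ≤ C) ∧ contRep u =ᵐ[volume] u := by
  obtain ⟨f, hf, ⟨C, hC⟩, hfu⟩ := hu.exists_continuous
  have hex : ∃ f : E3 → C2, Continuous f ∧ f =ᵐ[volume] u := ⟨f, hf, hfu⟩
  have hs : Continuous (contRep u) ∧ contRep u =ᵐ[volume] u := by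
    rw [contRep, dif_pos hex]
    exact hex.choose_spec
  -- Lebesgue measure charges every nonempty open set, so continuous representatives agree
  -- everywhere and the chosen one inherits the bound.
  have heq : contRep u = f :=
    (hs.1.ae_eq_iff_eq volume hf).1 (hs.2.trans hfu.symm)
  exact ⟨hs.1, ⟨C, fun x => heq ▸ hC x⟩, hs.2⟩

theorem InH2.continuous_inner {u v : HL} (hu : InH2 u) (hv : InH2 v) :
    Continuous fun x => inner ℂ (contRep u x) (contRep v x) :=
  hu.contRep_spec.1.inner hv.contRep_spec.1

theorem InH2.bounded_inner {u v : HL} (hu : InH2 u) (hv : InH2 v) :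
    ∃ C, ∀ x, ‖(inner ℂ (contRep u x) (contRep v x) : ℂ)‖ ≤ C := by
  obtain ⟨-, ⟨C, hC⟩, -⟩ := hu.contRep_spec
  obtain ⟨-, ⟨C', hC'⟩, -⟩ := hv.contRep_spec
  exact ⟨C * C', fun x => (norm_inner_le_norm _ _).trans
    (mul_le_mul (hC x) (hC' x) (norm_nonneg _) ((norm_nonneg _).trans (hC x)))⟩

/-! ### Pauli matrices -/

theorem sigma_apply (k : Fin 3) (v : C2) (i : Fin 2) :
    sigma k v i = pauli k i 0 * v 0 + pauli k i 1 * v 1 := by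
  simp [sigma, Matrix.ofLp_toEuclideanCLM, Matrix.mulVec, dotProduct, Fin.sum_univ_two]

theorem inner_C2 (v w : C2) : inner ℂ v w = w 0 * conj (v 0) + w 1 * conj (v 1) := by
  simp [PiLp.inner_apply, Fin.sum_univ_two]

theorem inner_sigma_left (k : Fin 3) (v w : C2) :
    inner ℂ (sigma k v) w = inner ℂ v (sigma k w) := by
  fin_cases k <;> simp [inner_C2, sigma_apply, pauli] <;> ring

theorem sigma_sigma_self (k : Fin 3) :
    (sigma k).comp (sigma k) = ContinuousLinearMap.id ℂ C2 := by
  ext v i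
  fin_cases k <;> fin_cases i <;> simp [sigma_apply, pauli, ← mul_assoc]

theorem sigma_sigma_succ (k : Fin 3) :
    (sigma k).comp (sigma (k + 1)) = Complex.I • sigma (k + 2) := by
  ext v i
  fin_cases k <;> fin_cases i <;> simp [sigma_apply, pauli, ← mul_assoc]

theorem sigma_sigma_succ_succ (k : Fin 3) :
    (sigma k).comp (sigma (k + 2)) = -Complex.I • sigma (k + 1) := by
  ext v i
  fin_cases k <;> fin_cases i <;> simp [sigma_apply, pauli, ← mul_assoc]

theorem sum_fin_three_shift (f : Fin 3 → ℂ) (k : Fin 3) :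
    ∑ l, f l = f k + f (k + 1) + f (k + 2) := by
  fin_cases k <;> simp [Fin.sum_univ_three] <;> ring

/-- `∑ₗ σₖ σₗ` in terms of single Pauli matrices. -/
theorem sum_sigma_sigma {z : Fin 3 → (C2 →L[ℂ] C2) → ℂ}
    (hz : ∀ l (c : ℂ) M, z l (c • M) = c * z l M) (k : Fin 3) :
    ∑ l, z l ((sigma k).comp (sigma l)) = z k (ContinuousLinearMap.id ℂ C2) +
      (Complex.I * z (k + 1) (sigma (k + 2)) - Complex.I * z (k + 2) (sigma (k + 1))) := by
  rw [sum_fin_three_shift _ k, sigma_sigma_self, sigma_sigma_succ, sigma_sigma_succ_succ, hz, hz]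
  ring

/-- The Clifford relations: a symmetric form sees only the diagonal of `σₖ σₗ`. -/
theorem sum_sum_sigma_sigma {y : Fin 3 → Fin 3 → (C2 →L[ℂ] C2) → ℂ}
    (hy : ∀ k l (c : ℂ) M, y k l (c • M) = c * y k l M) (hs : ∀ k l M, y k l M = y l k M) :
    ∑ k, ∑ l, y k l ((sigma k).comp (sigma l)) = ∑ k, y k k (ContinuousLinearMap.id ℂ C2) := by
  simp_rw [fun k => sum_sigma_sigma (hy k) k, Finset.sum_add_distrib]
  rw [add_eq_left]
  simp only [Fin.sum_univ_three]
  simp only [Fin.isValue, zero_add, Fin.reduceAdd]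
  -- The off-diagonal products of Pauli matrices are antisymmetric in `k`, `l`, so they cancel
  -- against a symmetric form.
  rw [hs 1 0, hs 2 0, hs 2 1]
  ring

/-! ### Quadratic expressions in the spinors -/

theorem diracL_coe (u : HL) : diracL u =ᵐ[volume]
    fun x => -Complex.I • ∑ k, sigma k (weakPartial k u x) := by
  have h1 := Lp.coeFn_smul (-Complex.I) (∑ k, (sigma k).compLp (weakPartial k u))
  have h2 := Lp.coeFn_finsetSum Finset.univ fun k => (sigma k).compLp (weakPartial k u)
  have h3 : ∀ᵐ x, ∀ k, (sigma k).compLp (weakPartial k u) x = sigma k (weakPartial k u x) :=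
    ae_all_iff.2 fun k => (sigma k).coeFn_compLp _
  filter_upwards [h1, h2, h3] with x e1 e2 e3
  rw [diracL, e1, Pi.smul_apply, e2, Finset.sum_apply]
  simp only [e3]

theorem inner_diracL_coe (u v : HL) : (fun x => inner ℂ (diracL u x) (diracL v x)) =ᵐ[volume]
    fun x => ∑ k, ∑ l, inner ℂ (weakPartial k u x)
      (((sigma k).comp (sigma l)) (weakPartial l v x)) := by
  filter_upwards [diracL_coe u, diracL_coe v] with x h1 h2
  rw [h1, h2, inner_smul_left, inner_smul_right, ← mul_assoc]
  have : conj (-Complex.I) * -Complex.I = 1 := by simp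
  rw [this, one_mul, sum_inner]
  refine Finset.sum_congr rfl fun k _ => ?_
  rw [inner_sum]
  refine Finset.sum_congr rfl fun l _ => ?_
  rw [inner_sigma_left]
  rfl

/-- The density of the spin-orbit coupling to the `k`-th component of a field. -/
def spinOrbitDensity (k : Fin 3) (u v : HL) (x : E3) : ℂ :=
  -(Complex.I * inner ℂ (u x) (sigma (k + 2) (weakPartial (k + 1) v x))) +
    Complex.I * inner ℂ (u x) (sigma (k + 1) (weakPartial (k + 2) v x))

/-- Cyclic rearrangement of the triple product `σ·(G × p)`, so that each component of `G` stands as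
a scalar factor and Fubini applies to it. -/
theorem inner_spinOrbitOp (G : E3 → E3) (u v : HL) (x : E3) :
    inner ℂ (u x) (spinOrbitOp G v x) = ∑ k, (G x k : ℂ) * spinOrbitDensity k u v x := by
  simp only [spinOrbitOp, spinOrbitDensity, map_smul, map_sub, Fin.sum_univ_three]
  simp only [Fin.isValue, zero_add, Fin.reduceAdd, inner_add_right, inner_smul_right,
    inner_sub_right]
  ring

section singleCentre

variable {u v : HL}

theorem InH2.kernelBound_diracL (hu : InH2 u) :
    KernelBound coulomb fun x => inner ℂ (diracL u x) (diracL v x) := by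
  refine KernelBound.congr ?_ (inner_diracL_coe u v).symm
  exact .sum _ measurable_coulomb fun k _ => .sum _ measurable_coulomb fun l _ =>
    (hu.h1Approx_weakPartial k).kernelBound_inner _ _

theorem InH2.kernelBound_spinOrbit (hu : InH2 u) (hv : InH2 v) (k : Fin 3) :
    KernelBound (coulombDeriv k) (spinOrbitDensity k u v) := by
  have h := fun (l : Fin 3) (M : C2 →L[ℂ] C2) =>
    (hu.h1Approx.kernelBound_sq_inner (hv.h1Approx_weakPartial l) M).coulombDeriv k
  have := ((h (k + 1) (sigma (k + 2))).const_mul (-Complex.I)).add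
    ((h (k + 2) (sigma (k + 1))).const_mul Complex.I)
  refine this.congr (ae_of_all _ fun x => ?_)
  simp [spinOrbitDensity]

theorem InH2.kernelBound_grad (hu : InH2 u) (hv : InH2 v) (k : Fin 3) :
    KernelBound (coulombDeriv k) fun x => inner ℂ (u x) (weakPartial k v x) :=
  (hu.h1Approx.kernelBound_sq_inner (hv.h1Approx_weakPartial k)
    (ContinuousLinearMap.id ℂ C2)).coulombDeriv k

theorem InH2.kernelBound_inner (hu : InH2 u) :
    KernelBound coulomb fun x => inner ℂ (u x) (v x) :=
  hu.h1Approx.kernelBound_inner v (ContinuousLinearMap.id ℂ C2)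

theorem InH2.kernelBound_gradgrad (hu : InH2 u) (k : Fin 3) :
    KernelBound coulomb fun x => inner ℂ (weakPartial k u x) (weakPartial k v x) :=
  (hu.h1Approx_weakPartial k).kernelBound_inner _ (ContinuousLinearMap.id ℂ C2)

/-! ### Identities for a single Coulomb centre -/

/-- `∫ |x - a|⁻¹ (ℒu)^* ℒv`. -/
def diracForm (u v : HL) (a : E3) : ℂ :=
  ∫ x, (coulomb (x - a) : ℂ) * inner ℂ (diracL u x) (diracL v x)

/-- `∫ |x - a|⁻¹ u^* Δv`. -/
def laplaceForm (u v : HL) (a : E3) : ℂ :=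
  ∫ x, (coulomb (x - a) : ℂ) * inner ℂ (u x) (weakLaplacian v x)

/-- `∫ (∇|x - a|⁻¹) · u^* ∇v`. -/
def gradForm (u v : HL) (a : E3) : ℂ :=
  ∑ k, ∫ x, (coulombDeriv k (x - a) : ℂ) * inner ℂ (u x) (weakPartial k v x)

/-- `∫ |x - a|⁻¹ (∇u)^* · ∇v`. -/
def kineticForm (u v : HL) (a : E3) : ℂ :=
  ∑ k, ∫ x, (coulomb (x - a) : ℂ) * inner ℂ (weakPartial k u x) (weakPartial k v x)

/-- `∫ u^* σ·(∇|x - a|⁻¹ × (-i∇)) v`. -/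
def spinOrbitForm (u v : HL) (a : E3) : ℂ :=
  ∑ k, ∫ x, (coulombDeriv k (x - a) : ℂ) * spinOrbitDensity k u v x

theorem InH2.weakLaplacian_coe (hv : InH2 v) : weakLaplacian v =ᵐ[volume]
    fun x => ∑ k, weakPartial k (weakPartial k v) x := by
  obtain ⟨-, -, -, h, -⟩ := hv.exists_approx
  rw [h]
  filter_upwards [Lp.coeFn_finsetSum Finset.univ fun k => weakPartial k (weakPartial k v)] with x hx
  rw [hx, Finset.sum_apply]

theorem InH2.weakPartial_comm (hv : InH2 v) (k l : Fin 3) :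
    weakPartial k (weakPartial l v) = weakPartial l (weakPartial k v) :=
  hv.exists_approx.2.2.1 l k

theorem InH2.integral_coulombDeriv_inner (hu : InH2 u) (hv : InH2 v) (M : C2 →L[ℂ] C2)
    (k l : Fin 3) (a : E3) :
    ∫ x, (coulombDeriv k (x - a) : ℂ) * inner ℂ (u x) (M (weakPartial l v x)) =
      -(∫ x, (coulomb (x - a) : ℂ) * inner ℂ (weakPartial k u x) (M (weakPartial l v x))) -
        ∫ x, (coulomb (x - a) : ℂ) *
          inner ℂ (u x) (M (weakPartial k (weakPartial l v) x)) := by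
  have h1 := ((hu.h1Approx_weakPartial k).kernelBound_inner (weakPartial l v) M).integrable a
  have h2 := (hu.h1Approx.kernelBound_inner (weakPartial k (weakPartial l v)) M).integrable a
  have h := (hu.h1Approx.hasWeakDeriv (hv.h1Approx_weakPartial l) M k).integral_coulombDeriv a
    (by simp only [mul_add]; exact h1.add h2)
    ((hu.h1Approx.kernelBound_sq_inner (hv.h1Approx_weakPartial l) M).integrable a)
  simp only [mul_add] at h
  rw [h, integral_add h1 h2]
  ring

theorem InH2.laplaceForm_eq (hu : InH2 u) (hv : InH2 v) (a : E3) :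
    laplaceForm u v a = ∑ k, ∫ x, (coulomb (x - a) : ℂ) *
      inner ℂ (u x) ((ContinuousLinearMap.id ℂ C2) (weakPartial k (weakPartial k v) x)) := by
  rw [← integral_finsetSum _ fun k _ => (hu.h1Approx.kernelBound_inner
    (weakPartial k (weakPartial k v)) (ContinuousLinearMap.id ℂ C2)).integrable a]
  refine integral_congr_ae ?_
  filter_upwards [hv.weakLaplacian_coe] with x hx
  rw [hx, inner_sum, Finset.mul_sum]
  rfl

/-- The spinless counterpart of the next integration by parts, later used only to show that the
interaction of `gradForm` is real. -/
theorem InH2.gradForm_eq (hu : InH2 u) (hv : InH2 v) (a : E3) :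
    gradForm u v a = -kineticForm u v a - laplaceForm u v a := by
  rw [hu.laplaceForm_eq hv, gradForm, kineticForm, ← Finset.sum_neg_distrib,
    ← Finset.sum_sub_distrib]
  exact Finset.sum_congr rfl fun k _ =>
    hu.integral_coulombDeriv_inner hv (ContinuousLinearMap.id ℂ C2) k k a

theorem integral_mul_inner_smul (w : E3 → ℂ) (f g : E3 → C2) (c : ℂ) (M : C2 →L[ℂ] C2) :
    ∫ x, w x * inner ℂ (f x) ((c • M) (g x)) = c * ∫ x, w x * inner ℂ (f x) (M (g x)) := by
  rw [← integral_const_mul]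
  refine integral_congr_ae (ae_of_all _ fun x => ?_)
  simp only [smul_apply, inner_smul_right]
  ring

/-- Moving `∂ₖ` off `u` in `∑ W (∂ₖu)^* σₖσₗ ∂ₗv` produces two terms. In the one with `∂ₖ∂ₗv`
symmetry leaves the Laplacian; in the one with `∂ₖW` the diagonal of `σₖσₗ` gives `gradForm` and the
rest the spin-orbit term. -/
theorem InH2.diracForm_eq (hu : InH2 u) (hv : InH2 v) (a : E3) :
    diracForm u v a = -laplaceForm u v a - gradForm u v a + spinOrbitForm u v a := by
  have hX : diracForm u v a = ∑ k, ∑ l, ∫ x, (coulomb (x - a) : ℂ) *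
      inner ℂ (weakPartial k u x) (((sigma k).comp (sigma l)) (weakPartial l v x)) := by
    have hi := fun (k l : Fin 3) => ((hu.h1Approx_weakPartial k).kernelBound_inner
      (weakPartial l v) ((sigma k).comp (sigma l))).integrable a
    simp_rw [fun k => (integral_finsetSum Finset.univ fun l _ => hi k l).symm]
    rw [← integral_finsetSum _ fun k _ => integrable_finsetSum _ fun l _ => hi k l]
    refine integral_congr_ae ?_
    filter_upwards [inner_diracL_coe u v] with x hx
    simp only [hx, Finset.mul_sum]
  have hY : ∑ k, ∑ l, ∫ x, (coulomb (x - a) : ℂ) * inner ℂ (u x)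
      (((sigma k).comp (sigma l)) (weakPartial k (weakPartial l v) x)) = laplaceForm u v a := by
    rw [hu.laplaceForm_eq hv]
    exact sum_sum_sigma_sigma (y := fun k l M => ∫ x, (coulomb (x - a) : ℂ) * inner ℂ (u x)
      (M (weakPartial k (weakPartial l v) x)))
      (fun k l c M => integral_mul_inner_smul _ _ _ c M)
      (fun k l M => by rw [hv.weakPartial_comm])
  have hZ : ∑ k, ∑ l, ∫ x, (coulombDeriv k (x - a) : ℂ) * inner ℂ (u x)
      (((sigma k).comp (sigma l)) (weakPartial l v x)) =
      gradForm u v a - spinOrbitForm u v a := by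
    rw [gradForm, spinOrbitForm, ← Finset.sum_sub_distrib]
    refine Finset.sum_congr rfl fun k _ => ?_
    have h1 := sum_sigma_sigma (z := fun l M => ∫ x, (coulombDeriv k (x - a) : ℂ) * inner ℂ (u x)
      (M (weakPartial l v x))) (fun l c M => integral_mul_inner_smul _ _ _ c M) k
    have hi := fun (l : Fin 3) (M : C2 →L[ℂ] C2) =>
      ((hu.h1Approx.kernelBound_sq_inner (hv.h1Approx_weakPartial l) M).coulombDeriv k).integrable a
    have h2 : ∫ x, (coulombDeriv k (x - a) : ℂ) * spinOrbitDensity k u v x =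
        -(Complex.I * ∫ x, (coulombDeriv k (x - a) : ℂ) *
          inner ℂ (u x) (sigma (k + 2) (weakPartial (k + 1) v x))) +
        Complex.I * ∫ x, (coulombDeriv k (x - a) : ℂ) *
          inner ℂ (u x) (sigma (k + 1) (weakPartial (k + 2) v x)) := by
      rw [← neg_mul, ← integral_const_mul, ← integral_const_mul, ← integral_add
        ((hi _ _).const_mul _) ((hi _ _).const_mul _)]
      refine integral_congr_ae (ae_of_all _ fun x => ?_)
      simp only [spinOrbitDensity]
      ring
    rw [h1, h2]
    simp only [ContinuousLinearMap.id_apply]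
    ring
  have hXYZ : ∑ k, ∑ l, ∫ x, (coulombDeriv k (x - a) : ℂ) * inner ℂ (u x)
      (((sigma k).comp (sigma l)) (weakPartial l v x)) =
      -diracForm u v a - laplaceForm u v a := by
    simp_rw [fun k l => hu.integral_coulombDeriv_inner hv ((sigma k).comp (sigma l)) k l a,
      Finset.sum_sub_distrib, Finset.sum_neg_distrib]
    rw [hX, hY]
  rw [hZ] at hXYZ
  linear_combination hXYZ

/-- The left side is `∫ ∇W · ∇(u^*v)`, on which `-ΔW` acts as a point charge at `a`; this is where
the continuous representatives enter. -/
theorem InH2.gradForm_add_conj (hu : InH2 u) (hv : InH2 v) (a : E3) :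
    gradForm u v a + conj (gradForm v u a) =
      pointCharge * inner ℂ (contRep u a) (contRep v a) := by
  let I := ContinuousLinearMap.id ℂ C2
  have hb := fun k => ((hu.h1Approx_weakPartial k).kernelBound_sq_inner hv.h1Approx I)
  have hb' := fun k => (hu.h1Approx.kernelBound_sq_inner (hv.h1Approx_weakPartial k) I)
  have key := sum_integral_coulombDeriv (cf := fun x => inner ℂ (contRep u x) (contRep v x))
    (fun k => hu.h1Approx.hasWeakDeriv hv.h1Approx I k) (hu.continuous_inner hv)
    (hu.bounded_inner hv) (by
      filter_upwards [hu.contRep_spec.2.2, hv.contRep_spec.2.2] with x h1 h2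
      rw [h1, h2]
      rfl) a fun k => by
      simp only [mul_add]
      exact ((hb k).integrable a).add ((hb' k).integrable a)
  rw [← key, gradForm, gradForm, map_sum, ← Finset.sum_add_distrib]
  refine Finset.sum_congr rfl fun k _ => ?_
  simp only [mul_add]
  rw [integral_add (((hb k).coulombDeriv k).integrable a) (((hb' k).coulombDeriv k).integrable a),
    ← integral_conj, add_comm]
  congr 1
  refine integral_congr_ae (ae_of_all _ fun x => ?_)
  simp [I]

theorem conj_kineticForm (u v : HL) (a : E3) :
    conj (kineticForm v u a) = kineticForm u v a := by
  rw [kineticForm, kineticForm, map_sum]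
  refine Finset.sum_congr rfl fun k _ => ?_
  rw [← integral_conj]
  refine integral_congr_ae (ae_of_all _ fun x => ?_)
  simp

/-- `⟨ℒu, ℒv⟩ = ⟨u, -Δv⟩`. -/
theorem InH2.inner_diracL (hu : InH2 u) (hv : InH2 v) :
    inner ℂ (diracL u) (diracL v) = -inner ℂ u (weakLaplacian v) := by
  -- The constant multiplier `1` in place of the Coulomb kernel turns the scheme for a single centre
  -- into the free identity.
  have hone : ∀ k, IsMultiplier k (fun _ => 1) (fun _ => 0) := fun k =>
    ⟨continuous_const, continuous_const, ⟨1, by simp⟩, ⟨0, by simp⟩, fun x => by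
      simpa using (hasFDerivAt_const (1 : ℝ) x).hasLineDerivAt (e k)⟩
  have hibp : ∀ (M : C2 →L[ℂ] C2) k l,
      ∫ x, (1 : ℂ) * inner ℂ (weakPartial k u x) (M (weakPartial l v x)) =
        -∫ x, (1 : ℂ) * inner ℂ (u x) (M (weakPartial k (weakPartial l v) x)) := by
    intro M k l
    have h := (hu.h1Approx.hasWeakDeriv (hv.h1Approx_weakPartial l) M k).ibp _ _ (hone k)
    simp only [Complex.ofReal_zero, zero_mul, integral_zero, Complex.ofReal_one, one_mul] at h ⊢
    rw [integral_add (integrable_inner_clm M _ _) (integrable_inner_clm M _ _)] at h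
    linear_combination h
  have hX : inner ℂ (diracL u) (diracL v) = ∑ k, ∑ l, ∫ x, (1 : ℂ) *
      inner ℂ (weakPartial k u x) (((sigma k).comp (sigma l)) (weakPartial l v x)) := by
    have hi := fun (k l : Fin 3) => integrable_inner_clm ((sigma k).comp (sigma l))
      (weakPartial k u) (weakPartial l v)
    simp only [one_mul]
    simp_rw [fun k => (integral_finsetSum Finset.univ fun l _ => hi k l).symm]
    rw [← integral_finsetSum _ fun k _ => integrable_finsetSum _ fun l _ => hi k l, L2.inner_def]
    exact integral_congr_ae (inner_diracL_coe u v)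
  have hY := sum_sum_sigma_sigma (y := fun k l M => ∫ x, (1 : ℂ) * inner ℂ (u x)
      (M (weakPartial k (weakPartial l v) x)))
      (fun k l c M => integral_mul_inner_smul _ _ _ c M)
      (fun k l M => by rw [hv.weakPartial_comm])
  rw [hX]
  simp_rw [hibp, Finset.sum_neg_distrib]
  rw [hY, L2.inner_def]
  congr 1
  simp only [one_mul]
  rw [← integral_finsetSum _ fun k _ => integrable_inner_clm (ContinuousLinearMap.id ℂ C2) u
    (weakPartial k (weakPartial k v))]
  refine integral_congr_ae ?_
  filter_upwards [hv.weakLaplacian_coe] with x hx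
  rw [hx, inner_sum]
  rfl

end singleCentre

/-! ### The charge density and point charges -/

section density

variable {q : ℕ} (u : Fin q → HL)

theorem measurable_density : Measurable (density u) :=
  Finset.measurable_fun_sum _ fun n _ => (Lp.stronglyMeasurable (u n)).measurable.norm.pow_const 2

theorem density_nonneg (x : E3) : 0 ≤ density u x := Finset.sum_nonneg fun _ _ => sq_nonneg _

theorem integrable_density : Integrable (density u) :=
  integrable_finsetSum _ fun n _ => integrable_norm_sq (u n)

/-- The measure `ρ_γ dx`. -/
def rhoMeasure : Measure E3 := volume.withDensity fun x => ENNReal.ofReal (density u x)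

instance : IsFiniteMeasure (rhoMeasure u) :=
  isFiniteMeasure_withDensity_ofReal (integrable_density u).2

/-- Orbitals in `L²` have finite total charge, so the electron cloud is a finite measure on the same
footing as the nuclei. -/
theorem meanField_eq_pairPot (μ : Measure E3) :
    meanField μ u = pairPot coulomb μ (rhoMeasure u) := by
  funext x
  rw [meanField, pairPot, nuclearV, directW, rhoMeasure,
    integral_withDensity_eq_integral_toReal_smul (measurable_density u).ennreal_ofReal
      (ae_of_all _ fun _ => ENNReal.ofReal_lt_top)]
  simp only [ENNReal.toReal_ofReal (density_nonneg u _), smul_eq_mul]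

end density

theorem coulomb_sub_comm (x y : E3) : coulomb (x - y) = coulomb (y - x) := by
  rw [coulomb, coulomb, norm_sub_rev]

theorem pairPot_zero_dirac (K : E3 → ℝ) (x y : E3) :
    pairPot K 0 (Measure.dirac x) y = K (y - x) := by
  simp [pairPot]

/-- A unit point charge is the pair `0`, `δₓ`, so the exchange kernels are covered by the same
statements as the mean field. -/
theorem coulomb_sub_eq_pairPot (x : E3) :
    (fun y => coulomb (x - y)) = pairPot coulomb 0 (Measure.dirac x) := by
  funext y
  rw [pairPot_zero_dirac, coulomb_sub_comm]

theorem pairIntegral_zero_dirac (x : E3) (f : E3 → ℂ) :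
    pairIntegral 0 (Measure.dirac x) f = f x := by
  simp [pairIntegral]

/-! ### Multipliers of integrable functions -/

/-- Multiplication by `f` preserves integrability with respect to every s-finite measure. -/
def PreservesIntegrable (f : E3 → ℂ) : Prop :=
  ∀ (ν : Measure E3) [SFinite ν] (w : E3 → ℂ), Integrable w ν → Integrable (fun a => w a * f a) ν

namespace PreservesIntegrable

variable {f g : E3 → ℂ}

theorem add (hf : PreservesIntegrable f) (hg : PreservesIntegrable g) :
    PreservesIntegrable fun a => f a + g a := fun ν _ w hw => by
  simp only [mul_add]
  exact (hf ν w hw).add (hg ν w hw)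

theorem sum {ι : Type*} (s : Finset ι) {f : ι → E3 → ℂ} (hf : ∀ i, PreservesIntegrable (f i)) :
    PreservesIntegrable fun a => ∑ i ∈ s, f i a := fun ν _ w hw => by
  simp only [Finset.mul_sum]
  exact integrable_finsetSum _ fun i _ => hf i ν w hw

theorem star (hf : PreservesIntegrable f) : PreservesIntegrable fun a => conj (f a) :=
  fun ν _ w hw => by
    have h := (Complex.conjLIE.integrable_comp_iff (μ := ν)).2
      (hf ν _ ((Complex.conjLIE.integrable_comp_iff (μ := ν)).2 hw))
    simpa using h

theorem integrable (hf : PreservesIntegrable f) (ν : Measure E3) [IsFiniteMeasure ν] :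
    Integrable f ν := by
  simpa using hf ν (fun _ => 1) (integrable_const 1)

theorem of_continuous_bounded (hf : Continuous f) (hb : ∃ C, ∀ x, ‖f x‖ ≤ C) :
    PreservesIntegrable f := fun ν _ w hw => by
  obtain ⟨C, hC⟩ := hb
  exact hw.mul_bdd hf.aestronglyMeasurable (ae_of_all _ hC)

theorem pairIntegral_add (hf : PreservesIntegrable f) (hg : PreservesIntegrable g)
    (ν₁ ν₂ : Measure E3) [IsFiniteMeasure ν₁] [IsFiniteMeasure ν₂] :
    pairIntegral ν₁ ν₂ (fun a => f a + g a) = pairIntegral ν₁ ν₂ f + pairIntegral ν₁ ν₂ g := by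
  simp only [pairIntegral]
  rw [integral_add (hf.integrable _) (hg.integrable _),
    integral_add (hf.integrable _) (hg.integrable _)]
  ring

end PreservesIntegrable

theorem KernelBound.preservesIntegrable {K : E3 → ℝ} {F : E3 → ℂ} (h : KernelBound K F) :
    PreservesIntegrable fun a => ∫ x, (K (x - a) : ℂ) * F x :=
  fun _ _ _ hw => h.integrable_weight hw

section forms

variable {u v : HL}

theorem InH2.preservesIntegrable_diracForm (hu : InH2 u) :
    PreservesIntegrable (diracForm u v) := hu.kernelBound_diracL.preservesIntegrable

theorem InH2.preservesIntegrable_laplaceForm (hu : InH2 u) :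
    PreservesIntegrable (laplaceForm u v) := hu.kernelBound_inner.preservesIntegrable

theorem InH2.preservesIntegrable_gradForm (hu : InH2 u) (hv : InH2 v) :
    PreservesIntegrable (gradForm u v) :=
  .sum _ fun k => (hu.kernelBound_grad hv k).preservesIntegrable

theorem InH2.preservesIntegrable_kineticForm (hu : InH2 u) :
    PreservesIntegrable (kineticForm u v) :=
  .sum _ fun k => (hu.kernelBound_gradgrad k).preservesIntegrable

theorem InH2.preservesIntegrable_spinOrbitForm (hu : InH2 u) (hv : InH2 v) :
    PreservesIntegrable (spinOrbitForm u v) :=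
  .sum _ fun k => (hu.kernelBound_spinOrbit hv k).preservesIntegrable

theorem InH2.preservesIntegrable_contRep (hu : InH2 u) (hv : InH2 v) :
    PreservesIntegrable fun a => inner ℂ (contRep u a) (contRep v a) :=
  .of_continuous_bounded (hu.continuous_inner hv) (hu.bounded_inner hv)

/-! ### Integrals of a potential against products of spinors -/

theorem inner_mul_smul (r : ℝ) (v w : C2) :
    inner ℂ v ((r : ℂ) • w) = (r : ℂ) * inner ℂ v w := inner_smul_right _ _ _

theorem integral_diracL_coulomb (u v : HL) (x : E3) :
    ∫ y, inner ℂ (diracL u y) ((coulomb (x - y) : ℂ) • diracL v y) = diracForm u v x := by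
  simp only [diracForm, inner_mul_smul, coulomb_sub_comm x]

theorem spinOrbit_weakGrad_coe (u v : HL) (ν₁ ν₂ : Measure E3) [IsFiniteMeasure ν₁]
    [IsFiniteMeasure ν₂] :
    (fun x => inner ℂ (u x) (spinOrbitOp (weakGrad (pairPot coulomb ν₁ ν₂)) v x)) =ᵐ[volume]
      fun x => ∑ k, (pairPot (coulombDeriv k) ν₁ ν₂ x : ℂ) * spinOrbitDensity k u v x := by
  filter_upwards [(weakGrad_spec (isWeakGradient_pairPot ν₁ ν₂)).2] with x hx
  simp only [inner_spinOrbitOp, hx, pairGrad_apply]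

theorem InH2.integrable_spinOrbit (hu : InH2 u) (hv : InH2 v) (ν₁ ν₂ : Measure E3)
    [IsFiniteMeasure ν₁] [IsFiniteMeasure ν₂] :
    Integrable fun x => inner ℂ (u x) (spinOrbitOp (weakGrad (pairPot coulomb ν₁ ν₂)) v x) :=
  (integrable_finsetSum _ fun k _ =>
    (hu.kernelBound_spinOrbit hv k).integrable_pairPot ν₁ ν₂).congr
      (spinOrbit_weakGrad_coe u v ν₁ ν₂).symm

theorem InH2.integral_spinOrbit (hu : InH2 u) (hv : InH2 v) (ν₁ ν₂ : Measure E3)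
    [IsFiniteMeasure ν₁] [IsFiniteMeasure ν₂] :
    ∫ x, inner ℂ (u x) (spinOrbitOp (weakGrad (pairPot coulomb ν₁ ν₂)) v x) =
      pairIntegral ν₁ ν₂ (spinOrbitForm u v) := by
  have hk := hu.kernelBound_spinOrbit hv
  rw [integral_congr_ae (spinOrbit_weakGrad_coe u v ν₁ ν₂),
    integral_finsetSum _ fun k _ => (hk k).integrable_pairPot ν₁ ν₂]
  simp_rw [fun k => (hk k).integral_pairPot ν₁ ν₂]
  simp only [pairIntegral, spinOrbitForm]
  rw [integral_finsetSum _ fun k _ => (hk k).preservesIntegrable.integrable ν₁,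
    integral_finsetSum _ fun k _ => (hk k).preservesIntegrable.integrable ν₂,
    Finset.sum_add_distrib, Finset.sum_neg_distrib]

end forms

/-! ### The mean-field interaction -/

section interaction

variable (μ : Measure E3) {q : ℕ} (u : Fin q → HL)

/-- Direct minus exchange interaction of the potentials `h m n` generated by pairs of orbitals. -/
def interaction (μ : Measure E3) (u : Fin q → HL) (h : Fin q → Fin q → E3 → ℂ) : ℂ :=
  (∑ n, pairIntegral μ (rhoMeasure u) (h n n)) -
    ∑ m, ∑ n, ∫ x, inner ℂ (u n x) (u m x) * h m n x

theorem integrable_inner (v w : HL) : Integrable fun x => inner ℂ (v x) (w x) :=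
  L2.integrable_inner v w

theorem interaction_add [IsFiniteMeasure μ] {h h' : Fin q → Fin q → E3 → ℂ}
    (hh : ∀ m n, PreservesIntegrable (h m n)) (hh' : ∀ m n, PreservesIntegrable (h' m n)) :
    interaction μ u (fun m n a => h m n a + h' m n a) =
      interaction μ u h + interaction μ u h' := by
  simp only [interaction, mul_add]
  simp_rw [fun n => (hh n n).pairIntegral_add (hh' n n) μ (rhoMeasure u),
    fun m n => integral_add (hh m n _ _ (integrable_inner (u n) (u m)))
      (hh' m n _ _ (integrable_inner (u n) (u m))), Finset.sum_add_distrib]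
  ring

theorem interaction_const_mul (c : ℂ) (h : Fin q → Fin q → E3 → ℂ) :
    interaction μ u (fun m n a => c * h m n a) = c * interaction μ u h := by
  simp only [interaction, pairIntegral, mul_left_comm _ c, integral_const_mul, mul_sub,
    Finset.mul_sum, mul_add, mul_neg]

/-- Conjugation turns the weight `uₙ^* uₘ` into `uₘ^* uₙ`, which the double sum undoes. In
particular, Hermitian families have real interaction. -/
theorem interaction_conj (h : Fin q → Fin q → E3 → ℂ) :
    interaction μ u (fun m n a => conj (h n m a)) = conj (interaction μ u h) := by
  simp only [interaction, pairIntegral, map_sub, map_sum, map_add, map_neg, ← integral_conj,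
    map_mul, inner_conj_symm]
  rw [Finset.sum_comm]

variable {μ} {u}

theorem E2_eq_interaction [IsFiniteMeasure μ] (hu : ∀ n, InH2 (u n)) {c : ℝ} (hc : c ≠ 0)
    (ε : Fin q → ℝ) : 4 * (c : ℂ) ^ 2 * E2 c μ u ε =
      -(∑ n, (ε n : ℂ) * inner ℂ (diracL (u n)) (diracL (u n))) +
        interaction μ u fun m n => diracForm (u m) (u n) := by
  have h1 : ∀ n, ∫ x, inner ℂ (diracL (u n) x) ((meanField μ u x : ℂ) • diracL (u n) x) =
      pairIntegral μ (rhoMeasure u) (diracForm (u n) (u n)) := fun n => by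
    simp only [inner_mul_smul, meanField_eq_pairPot]
    exact (hu n).kernelBound_diracL.integral_pairPot _ _
  have hc' : (c : ℂ) ≠ 0 := Complex.ofReal_ne_zero.2 hc
  simp only [E2, h1, integral_diracL_coulomb, interaction]
  field_simp
  ring

theorem Eso_eq_interaction [IsFiniteMeasure μ] (hu : ∀ n, InH2 (u n)) :
    Eso μ u = interaction μ u fun m n => spinOrbitForm (u m) (u n) := by
  simp only [Eso, interaction, meanField_eq_pairPot, coulomb_sub_eq_pairPot]
  simp_rw [fun n => (hu n).integral_spinOrbit (hu n) μ (rhoMeasure u),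
    fun m n x => (hu m).integral_spinOrbit (hu n) 0 (Measure.dirac x), pairIntegral_zero_dirac]

theorem signedIntegral_coulomb (x : E3) {f : E3 → ℂ} (hf : Continuous f)
    (hb : ∃ C, ∀ x, ‖f x‖ ≤ C) :
    signedIntegral (distribLaplacian fun y => coulomb (x - y)) f = -pointCharge * f x := by
  rw [coulomb_sub_eq_pairPot, (distribLaplacian_pairPot _ _).2 hf hb, pairIntegral_zero_dirac]
  ring

/-- Each Laplacian of a potential is `-κ` times its charge, so the Darwin term only evaluates
orbital products at the charges. -/
theorem ED_eq_interaction [IsFiniteMeasure μ] (hu : ∀ n, InH2 (u n)) :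
    ED μ u = -(pointCharge / 2 : ℂ) *
      interaction μ u fun m n a => inner ℂ (contRep (u m) a) (contRep (u n) a) := by
  simp only [ED, interaction]
  simp_rw [fun m n x => signedIntegral_coulomb x ((hu m).continuous_inner (hu n))
      ((hu m).bounded_inner (hu n)), meanField_eq_pairPot,
    fun n => (distribLaplacian_pairPot μ (rhoMeasure u)).2 ((hu n).continuous_inner (hu n))
      ((hu n).bounded_inner (hu n)), mul_left_comm _ (-(pointCharge : ℂ)), integral_const_mul,
    ← Finset.mul_sum, Finset.sum_neg_distrib, ← Finset.mul_sum]
  ring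

/-! ### The Hartree–Fock equations -/

/-- Exhibits the exchange potential as a convolution with the integrable weight `ψ^* uₘ`, the shape
in which Fubini moves the Coulomb kernel onto the other factor. -/
theorem inner_exchangeW (hu : ∀ n, InH2 (u n)) (ψ : HL) (x : E3) (w : C2) :
    inner ℂ (exchangeW u ψ x) w =
      ∑ m, (∫ y, inner ℂ (ψ y) (u m y) * (coulomb (x - y) : ℂ)) * inner ℂ (u m x) w := by
  have hi : ∀ m, Integrable fun y => (coulomb (x - y) : ℂ) * inner ℂ (u m y) (ψ y) := fun m => by
    simp only [coulomb_sub_comm x]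
    exact (hu m).kernelBound_inner.integrable x
  have h1 : exchangeW u ψ x =
      ∑ m, (∫ y, (coulomb (x - y) : ℂ) * inner ℂ (u m y) (ψ y)) • u m x := by
    simp only [exchangeW, gammaKernel, Finset.smul_sum, smul_smul]
    rw [integral_finsetSum _ fun m _ => (hi m).smul_const _]
    simp only [integral_smul_const]
  rw [h1, sum_inner]
  refine Finset.sum_congr rfl fun m _ => ?_
  rw [inner_smul_left, ← integral_conj]
  simp only [map_mul, Complex.conj_ofReal, inner_conj_symm, mul_comm]

/-- Pairing the `n`-th equation with `Δuₙ` and summing: the kinetic term becomes the mass-velocity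
term, and the two potentials give the direct and exchange parts of `laplaceForm`. -/
theorem IsHFState.sum_eigenvalue_inner_laplacian [IsFiniteMeasure μ] {ε : Fin q → ℝ}
    (h : IsHFState μ u ε) : ∑ n, (ε n : ℂ) * inner ℂ (u n) (weakLaplacian (u n)) =
      Emv u + interaction μ u fun m n => laplaceForm (u m) (u n) := by
  have hu := h.mem_domain
  have key : ∀ n, (ε n : ℂ) * inner ℂ (u n) (weakLaplacian (u n)) =
      -(1 / 2 : ℂ) * inner ℂ (-weakLaplacian (u n)) (-weakLaplacian (u n)) +
      pairIntegral μ (rhoMeasure u) (laplaceForm (u n) (u n)) -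
      ∑ m, ∫ x, inner ℂ (u n x) (u m x) * laplaceForm (u m) (u n) x := by
    intro n
    have hK : ∀ m, KernelBound coulomb fun x => inner ℂ (u m x) (weakLaplacian (u n) x) :=
      fun m => (hu m).kernelBound_inner
    have hI := fun m => integrable_inner (u n) (u m)
    have h1 : (fun x => (ε n : ℂ) * inner ℂ (u n x) (weakLaplacian (u n) x)) =ᵐ[volume] fun x =>
        -(1 / 2 : ℂ) * inner ℂ (weakLaplacian (u n) x) (weakLaplacian (u n) x) +
        (pairPot coulomb μ (rhoMeasure u) x : ℂ) * inner ℂ (u n x) (weakLaplacian (u n) x) -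
        ∑ m, (∫ y, inner ℂ (u n y) (u m y) * (coulomb (x - y) : ℂ)) *
          inner ℂ (u m x) (weakLaplacian (u n) x) := by
      filter_upwards [h.eigen n] with x hx
      -- The equation enters in the conjugate-linear slot; its scalars come out unchanged because
      -- the mean field and `ε` are real.
      have := congrArg (fun z => inner ℂ z (weakLaplacian (u n) x)) hx
      simp only [inner_sub_left, inner_add_left, inner_smul_left, inner_exchangeW hu,
        Complex.conj_ofReal, meanField_eq_pairPot] at this
      rw [← this, map_neg, map_div₀, map_one, Complex.conj_ofNat]
    have hi1 := (integrable_inner (weakLaplacian (u n)) (weakLaplacian (u n))).const_mul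
      (-(1 / 2 : ℂ))
    have hi2 := (hK n).integrable_pairPot μ (rhoMeasure u)
    have hi3 := fun m => (hK m).integrable_convolution (hI m)
    rw [inner_neg_neg, L2.inner_def, L2.inner_def, ← integral_const_mul, integral_congr_ae h1,
      integral_sub (by exact hi1.add hi2) (integrable_finsetSum _ fun m _ => hi3 m),
      integral_add hi1 hi2, integral_const_mul, (hK n).integral_pairPot μ (rhoMeasure u),
      integral_finsetSum _ fun m _ => hi3 m]
    simp_rw [fun m => (hK m).integral_convolution (hI m)]
    rfl
  simp_rw [key, Finset.sum_sub_distrib, Finset.sum_add_distrib]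
  rw [Emv, interaction, Finset.mul_sum, Finset.sum_comm (f := fun n m => ∫ x, inner ℂ (u n x)
    (u m x) * laplaceForm (u m) (u n) x)]
  ring

/-! ### The decomposition of the relativistic correction -/

theorem conj_Emv (u : Fin q → HL) : conj (Emv u) = Emv u := by
  simp only [Emv, map_mul, map_sum, inner_conj_symm, map_neg, map_div₀, map_one,
    Complex.conj_ofNat]

/-- The point-source identity yields twice the real part. The Hartree–Fock equations make the
quantity real, so nothing else remains. -/
theorem IsHFState.interaction_gradForm [IsFiniteMeasure μ] {ε : Fin q → ℝ}
    (h : IsHFState μ u ε) : interaction μ u (fun m n => gradForm (u m) (u n)) =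
      (pointCharge / 2 : ℂ) *
        interaction μ u fun m n a => inner ℂ (contRep (u m) a) (contRep (u n) a) := by
  have hu := h.mem_domain
  have hG : ∀ m n, PreservesIntegrable (gradForm (u m) (u n)) :=
    fun m n => (hu m).preservesIntegrable_gradForm (hu n)
  have hT : ∀ m n, PreservesIntegrable (kineticForm (u m) (u n)) :=
    fun m n => (hu m).preservesIntegrable_kineticForm
  have hL : ∀ m n, PreservesIntegrable (laplaceForm (u m) (u n)) :=
    fun m n => (hu m).preservesIntegrable_laplaceForm
  have h1 : interaction μ u (fun m n => kineticForm (u m) (u n)) +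
      interaction μ u (fun m n => laplaceForm (u m) (u n)) =
      -interaction μ u (fun m n => gradForm (u m) (u n)) := by
    rw [← interaction_add μ u hT hL, ← neg_one_mul, ← interaction_const_mul]
    congr 1
    funext m n a
    rw [(hu m).gradForm_eq (hu n)]
    ring
  have h2 : conj (interaction μ u fun m n => kineticForm (u m) (u n)) =
      interaction μ u fun m n => kineticForm (u m) (u n) := by
    rw [← interaction_conj]
    simp only [conj_kineticForm]
  have h3 : conj (interaction μ u fun m n => laplaceForm (u m) (u n)) =
      interaction μ u fun m n => laplaceForm (u m) (u n) := by
    -- Reality of this term comes from the equations: it equals `∑ εₙ⟨uₙ, Δuₙ⟩ - E_mv`, and `⟨uₙ,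
    -- Δuₙ⟩ = -⟨ℒuₙ, ℒuₙ⟩` is real.
    rw [eq_sub_iff_add_eq'.2 h.sum_eigenvalue_inner_laplacian.symm, map_sub, conj_Emv, map_sum]
    congr 1
    refine Finset.sum_congr rfl fun n _ => ?_
    rw [← neg_neg (inner ℂ (u n) (weakLaplacian (u n))), ← (hu n).inner_diracL (hu n)]
    simp
  have h4 : interaction μ u (fun m n => gradForm (u m) (u n)) +
      conj (interaction μ u fun m n => gradForm (u m) (u n)) = pointCharge *
        interaction μ u fun m n a => inner ℂ (contRep (u m) a) (contRep (u n) a) := by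
    rw [← interaction_conj, ← interaction_add μ u hG fun m n => (hG n m).star,
      ← interaction_const_mul]
    congr 1
    funext m n a
    exact (hu m).gradForm_add_conj (hu n) a
  have h5 := congrArg conj h1
  rw [map_add, map_neg, h2, h3] at h5
  linear_combination (1 / 2 : ℂ) * h4 + (1 / 2 : ℂ) * h1 - (1 / 2 : ℂ) * h5

/-- The eigenvalue term supplies `+I(L)` and the single-centre identity `-I(L)`; what is left is
`E_mv + I(S) - I(G)`. -/
theorem IsHFState.E2_eq [IsFiniteMeasure μ] {ε : Fin q → ℝ} (h : IsHFState μ u ε) {c : ℝ}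
    (hc : c ≠ 0) : 4 * (c : ℂ) ^ 2 * E2 c μ u ε = Emv u + ED μ u + Eso μ u := by
  have hu := h.mem_domain
  have h1 : interaction μ u (fun m n => diracForm (u m) (u n)) +
      interaction μ u (fun m n => laplaceForm (u m) (u n)) +
      interaction μ u (fun m n => gradForm (u m) (u n)) =
      interaction μ u fun m n => spinOrbitForm (u m) (u n) := by
    have hD : ∀ m n, PreservesIntegrable (diracForm (u m) (u n)) :=
      fun m n => (hu m).preservesIntegrable_diracForm
    have hL : ∀ m n, PreservesIntegrable (laplaceForm (u m) (u n)) :=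
      fun m n => (hu m).preservesIntegrable_laplaceForm
    rw [← interaction_add μ u hD hL, ← interaction_add μ u (fun m n => (hD m n).add (hL m n))
      fun m n => (hu m).preservesIntegrable_gradForm (hu n)]
    congr 1
    funext m n a
    rw [(hu m).diracForm_eq (hu n)]
    ring
  have h2 := h.sum_eigenvalue_inner_laplacian
  have h3 : ∑ n, (ε n : ℂ) * inner ℂ (diracL (u n)) (diracL (u n)) =
      -∑ n, (ε n : ℂ) * inner ℂ (u n) (weakLaplacian (u n)) := by
    simp_rw [fun n => (hu n).inner_diracL (hu n), mul_neg, Finset.sum_neg_distrib]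
  rw [E2_eq_interaction hu hc, Eso_eq_interaction hu, ED_eq_interaction hu, h3, neg_neg]
  linear_combination h1 + h2 - h.interaction_gradForm

theorem IsHFState.wellDefined [IsFiniteMeasure μ] {ε : Fin q → ℝ} (h : IsHFState μ u ε) :
    WellDefined μ u := by
  have hu := h.mem_domain
  refine
    { weakPartial_eq := fun n k => (hu n).exists_approx.1 k
      weakLaplacian_eq := fun n => (hu n).exists_approx.2.1
      contRep_spec := fun n => ⟨(hu n).contRep_spec.1, (hu n).contRep_spec.2.2⟩
      laplacian_meanField := ?_
      laplacian_coulomb := fun x => ?_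
      gradient_meanField := ?_
      gradient_coulomb := fun x => ?_
      integrable_direct := fun n => ?_
      integrable_exchange_inner := fun m n x => ?_
      integrable_exchange := fun m n => ?_
      integrable_darwin := fun n => ?_
      integrable_darwin_exchange_inner := fun m n x => ?_
      integrable_darwin_exchange := fun m n => ?_
      integrable_spinOrbit := fun n => ?_
      integrable_spinOrbit_exchange_inner := fun m n x => ?_
      integrable_spinOrbit_exchange := fun m n => ?_ }
  · rw [meanField_eq_pairPot]
    exact (distribLaplacian_pairPot _ _).1
  · rw [coulomb_sub_eq_pairPot]
    exact (distribLaplacian_pairPot _ _).1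
  · rw [meanField_eq_pairPot]
    exact (weakGrad_spec (isWeakGradient_pairPot _ _)).1
  · rw [coulomb_sub_eq_pairPot]
    exact (weakGrad_spec (isWeakGradient_pairPot _ _)).1
  · simp only [inner_mul_smul, meanField_eq_pairPot]
    exact (hu n).kernelBound_diracL.integrable_pairPot _ _
  · simp only [inner_mul_smul, coulomb_sub_comm x]
    exact (hu m).kernelBound_diracL.integrable x
  · simp only [integral_diracL_coulomb]
    exact (hu m).preservesIntegrable_diracForm _ _ (integrable_inner _ _)
  · exact signedIntegrable_of_continuous_bounded ((hu n).continuous_inner (hu n))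
      ((hu n).bounded_inner (hu n)) _
  · exact signedIntegrable_of_continuous_bounded ((hu m).continuous_inner (hu n))
      ((hu m).bounded_inner (hu n)) _
  · simp only [signedIntegral_coulomb _ ((hu m).continuous_inner (hu n))
      ((hu m).bounded_inner (hu n)), mul_left_comm _ (-(pointCharge : ℂ))]
    exact ((hu m).preservesIntegrable_contRep (hu n) _ _ (integrable_inner _ _)).const_mul _
  · rw [meanField_eq_pairPot]
    exact (hu n).integrable_spinOrbit (hu n) _ _
  · rw [coulomb_sub_eq_pairPot]
    exact (hu m).integrable_spinOrbit (hu n) _ _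
  · simp only [coulomb_sub_eq_pairPot]
    simp_rw [fun x => (hu m).integral_spinOrbit (hu n) 0 (Measure.dirac x),
      pairIntegral_zero_dirac]
    exact (hu m).preservesIntegrable_spinOrbitForm (hu n) _ _ (integrable_inner _ _)

end interaction

end HartreeFock

end

theorem mainTheorem4 (μ : MeasureTheory.Measure HartreeFock.E3) [MeasureTheory.IsFiniteMeasure μ]
    (c : ℝ) (hc : 0 < c) (q : ℕ) (u : Fin q → HartreeFock.HL) (ε : Fin q → ℝ)
    (hu : HartreeFock.IsHFState μ u ε) :
    HartreeFock.WellDefined μ u ∧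
      4 * (c : ℂ) ^ 2 * HartreeFock.E2 c μ u ε =
        HartreeFock.Emv u + HartreeFock.ED μ u + HartreeFock.Eso μ u :=
  ⟨hu.wellDefined, hu.E2_eq hc.ne'⟩
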